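/- **Setting.** Let $\mathcal X$ be a sample space with reference measure $dx$, partitioned into measurable cells $\mathcal X_1,\dots,\mathcal X_K$. Let $f\ge 0$ be an integrable unnormalised target density with $Z_a:=\int_{\mathcal X_a} f(x)\,dx>0$ for every $a$, and put $\pi_a:=Z_a/\sum_b Z_b$. For each $a$ let $g_a$ be a probability density that vanishes outside $\mathcal X_a$ and is such that $f=0$ almost everywhere on $\{x\in\mathcal X_a: g_a(x)=0\}$. **Sub-Gaussianity.** Let $\tau_1,\dots,\tau_K\ge 0$ be known numbers such that, for each $a$, the localized importance weight $Y_a=f(x)/g_a(x)$ with $x\sim g_a$ satisfies $\mathbb E[\exp(\theta(Y_a-\mathbb E Y_a))]\le\exp(\tfrac12\tau_a^2\theta^2)$ for all $\theta\in\mathbb R$. **Algorithm (Daisee).** In the iterations $t=1,\dots,K$ set $A_t=t$ and draw one sample $x_t\sim g_t$ from each cell. In each iteration $t\ge K+1$, given the past, draw an arm $A_t$ with $\mathbb P(A_t=a)=q_{at}$ and then a sample $x_t\sim g_{A_t}$, where $$q_{a,t+1}=\frac{\hat Z_{at}+\sigma_{at}}{\sum_{b=1}^K(\hat Z_{bt}+\sigma_{bt})},\qquad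 \hat Z_{at}=\frac1{N_{at}}\sum_{s\le t:\,A_s=a}\frac{f(x_s)}{g_a(x_s)},\qquad N_{at}=\#\{s\le t: A_s=a\},$$ $$\sigma_{at}=c\,\tau_a\sqrt{\frac{\log t}{N_{at}}},\qquad c=\sqrt{4.14\,\log_2(2e)}.$$ **Theorem.** Let $R_t=\sum_a\pi_a\log(\pi_a/q_{at})$, the KL divergence between $(\pi_a)_a$ and $(q_{at})_a$, for $t\ge K+1$. Then, for every $t\ge K+1$, all $q_{at}$ are almost surely positive and $R_t$ is integrable. Moreover, as $t\to\infty$ and $T\to\infty$, with constants that may depend on the problem but not on $t$ or $T$, the instantaneous pseudo-regret satisfies $$\mathbb E[R_t]=O\big(t^{-1/2}(\log t)^{3/4}\big),$$ and the cumulative pseudo-regret of Daisee satisfies $$\mathbb E\Big[\sum_{t=K+1}^{T}R_t\Big]=O\big(\sqrt T\,(\log T)^{3/4}\big).$$ -/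

import Mathlib

open MeasureTheory ProbabilityTheory Filter Asymptotics
open scoped NNReal ENNReal

noncomputable section

namespace Daisee

/-- The importance sampling problem on a sample space `X` with reference measure `μ` (written `dx`):
an unnormalised target density `f`, a partition of `X` into the `K` cells `cell a`, and, for every
cell, a proposal density `g a` that lives on this cell and dominates `f` there. -/
structure Problem (K : ℕ) (X : Type*) [MeasurableSpace X] (μ : Measure X) where
  /-- the unnormalised target density -/
  f : X → ℝ
  /-- the cells of the partition -/
  cell : Fin K → Set X
  /-- the proposal densities on the cells -/
  g : Fin K → X → ℝ
  measurable_f : Measurable f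
  f_nonneg : ∀ x, 0 ≤ f x
  integrable_f : Integrable f μ
  measurableSet_cell : ∀ a, MeasurableSet (cell a)
  cell_disjoint : Pairwise fun a b => Disjoint (cell a) (cell b)
  cell_cover : ⋃ a, cell a = Set.univ
  measurable_g : ∀ a, Measurable (g a)
  g_nonneg : ∀ a x, 0 ≤ g a x
  g_eq_zero_of_notMem : ∀ a x, x ∉ cell a → g a x = 0
  lintegral_g : ∀ a, ∫⁻ x, ENNReal.ofReal (g a x) ∂μ = 1
  f_eq_zero_of_g_eq_zero : ∀ a, ∀ᵐ x ∂μ, x ∈ cell a → g a x = 0 → f x = 0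

variable {K : ℕ} {X : Type*} [MeasurableSpace X] {μ : Measure X}

namespace Problem

/-- The proposal distribution on cell `a`, with density `g a`. -/
def G (p : Problem K X μ) (a : Fin K) : Measure X :=
  μ.withDensity fun x => ENNReal.ofReal (p.g a x)

/-- The localized importance weight of a sample `x` from cell `a`. -/
def weight (p : Problem K X μ) (a : Fin K) (x : X) : ℝ := p.f x / p.g a x

/-- The unnormalised target mass `Z_a` of cell `a`. -/
def Z (p : Problem K X μ) (a : Fin K) : ℝ := ∫ x in p.cell a, p.f x ∂μ

/-- The target probability `π_a = Z_a / ∑ b, Z_b` of cell `a`. -/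
def targetProb (p : Problem K X μ) (a : Fin K) : ℝ := p.Z a / ∑ b, p.Z b

/-- Sub-Gaussianity: under `g a` the localized weight, centred at its mean, has a moment generating
function that is everywhere finite and bounded by `exp (τ_a ^ 2 * θ ^ 2 / 2)`. -/
def SubGaussianWeights (p : Problem K X μ) (τ : Fin K → ℝ≥0) : Prop :=
  ∀ a, HasSubgaussianMGF (fun x => p.weight a x - ∫ y, p.weight a y ∂(p.G a)) (τ a ^ 2) (p.G a)

end Problem

/-- The constant `c = √(4.14 log₂ (2e))` of the optimism boost. -/
def boostConst : ℝ := √(4.14 * Real.logb 2 (2 * Real.exp 1))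

section Run

variable {Ω : Type*}

/-- `N_{at}`: the number of iterations `1 ≤ s ≤ t` in which arm `a` was chosen. -/
def pulls (A : ℕ → Ω → Fin K) (a : Fin K) (t : ℕ) (ω : Ω) : ℕ :=
  ((Finset.Icc 1 t).filter fun s => A s ω = a).card

/-- The Monte Carlo estimate of `Z_a` after iteration `t`. -/
def estimate (p : Problem K X μ) (A : ℕ → Ω → Fin K) (x : ℕ → Ω → X) (a : Fin K) (t : ℕ)
    (ω : Ω) : ℝ :=
  (∑ s ∈ (Finset.Icc 1 t).filter fun s => A s ω = a, p.weight a (x s ω)) / (pulls A a t ω : ℝ)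

/-- The optimism boost `σ_{at} = c τ_a √(log t / N_{at})`. -/
def boost (τ : Fin K → ℝ≥0) (A : ℕ → Ω → Fin K) (a : Fin K) (t : ℕ) (ω : Ω) : ℝ :=
  boostConst * (τ a : ℝ) * √(Real.log (t : ℝ) / (pulls A a t ω : ℝ))

/-- The proposal probability `q_{at}` of arm `a` in iteration `t` (used for `t ≥ K + 1`), computed
from the estimates and the boosts after iteration `t - 1`. -/
def proposal (p : Problem K X μ) (τ : Fin K → ℝ≥0) (A : ℕ → Ω → Fin K) (x : ℕ → Ω → X)
    (a : Fin K) (t : ℕ) (ω : Ω) : ℝ :=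
  (estimate p A x a (t - 1) ω + boost τ A a (t - 1) ω) /
    ∑ b, (estimate p A x b (t - 1) ω + boost τ A b (t - 1) ω)

/-- The regret `R_t`: the KL divergence between `(π_a)` and `(q_{at})`. -/
def regret (p : Problem K X μ) (τ : Fin K → ℝ≥0) (A : ℕ → Ω → Fin K) (x : ℕ → Ω → X)
    (t : ℕ) (ω : Ω) : ℝ :=
  ∑ a, p.targetProb a * Real.log (p.targetProb a / proposal p τ A x a t ω)

/-- `A` (chosen arms) and `x` (samples), indexed by the iterations `1, 2, …`, are a run of Daisee
on the probability space `(Ω, P)`, where `ℱ t` is the information after iteration `t`.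
The first `K` iterations draw one sample from each cell. In iteration `t + 1 > K`, given the past,
arm `a` is drawn with probability `q_{a,t+1}` and then the sample is drawn from `g a`. -/
structure IsRun {mΩ : MeasurableSpace Ω} (p : Problem K X μ) (τ : Fin K → ℝ≥0) (P : Measure Ω)
    (ℱ : Filtration ℕ mΩ)
    (A : ℕ → Ω → Fin K) (x : ℕ → Ω → X) : Prop where
  measurable_arm : ∀ t, 1 ≤ t → Measurable[ℱ t] (A t)
  measurable_sample : ∀ t, 1 ≤ t → Measurable[ℱ t] (x t)
  init_arm : ∀ a : Fin K, ∀ᵐ ω ∂P, A (a + 1) ω = a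
  init_sample : ∀ (a : Fin K) (B : Set X), MeasurableSet B →
    P[({ω | x (a + 1) ω ∈ B}.indicator fun _ => (1 : ℝ)) | ℱ a] =ᵐ[P] fun _ => (p.G a).real B
  step : ∀ t, K ≤ t → ∀ (a : Fin K) (B : Set X), MeasurableSet B →
    P[({ω | A (t + 1) ω = a ∧ x (t + 1) ω ∈ B}.indicator fun _ => (1 : ℝ)) | ℱ t]
      =ᵐ[P] fun ω => proposal p τ A x a (t + 1) ω * (p.G a).real B

end Run

end Daisee

end

/-! The reason is optimism. Write `V_a` for the score, estimate plus boost. While every estimate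
lies within its boost of `Z_a`, one has `Z_a ≤ V_a ≤ Z_a + 2σ_a`, so each ratio `π_a / q_a` is at
most `∑ V / ∑ Z`. Since `log y ≤ y - 1`, the regret is at most `2 ∑ σ / ∑ Z`
(`sum_mul_log_div_le_of_close`). It remains to see that the boosts are small.

Under the same event the total score is `O(√(log t))`, because a boost never exceeds `c τ_a √(log
t)`. Hence every arm keeps probability of order at least `1 / √(log t)`. If this lasts over the
second half of the iterations, each arm is pulled of order `t / √(log t)` times with high
probability (`measure_pulls_lt_le`). Then `σ` is of order `√(log t · √(log t) / t)`, which is the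
rate `(log t)^(3/4) / √t`.

Both failure probabilities come from nonnegative supermartingales: products of factors whose
conditional mean is bounded under every arm (`lintegral_step`). For the estimates, Chernoff's bound
with `c² ≥ 10` gives `t⁻⁵` for each sign and each value of the pull count. Union bounds over counts
and times leave `O(t⁻³)` (`exists_measure_compl_wellExplored_le`).

On the exceptional event the regret is at most `C √t` plus the sum of all weights
(`exists_regret_le`), whose second moment is `O(t²)`. Against probability `O(t⁻³)` this contributes
only `O(t^(-1/2))`. Summing `1 / √t` then gives the cumulative bound. -/

namespace Daisee

/-- A conditional probability computes integrals of measurable weights over the event. -/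
theorem setLIntegral_eq_of_condExp {Ω : Type*} {m m0 : MeasurableSpace Ω} {P : Measure Ω}
    [IsFiniteMeasure P] (hm : m ≤ m0) {S : Set Ω} (hS : MeasurableSet S) {φ : Ω → ℝ}
    (hφ : ∀ ω, 0 ≤ φ ω) (h : P[S.indicator (fun _ => (1 : ℝ)) | m] =ᵐ[P] φ)
    {U : Ω → ℝ≥0∞} (hU : Measurable[m] U) :
    ∫⁻ ω in S, U ω ∂P = ∫⁻ ω, U ω * ENNReal.ofReal (φ ω) ∂P := by
  have hint : Integrable φ P := integrable_condExp.congr h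
  have hmeas : AEMeasurable (fun ω => ENNReal.ofReal (φ ω)) P :=
    hint.aestronglyMeasurable.aemeasurable.ennreal_ofReal
  -- Equality of the two measures on the small σ-algebra handles every measurable `U` at once, with
  -- no integrability condition.
  have key : (P.restrict S).trim hm =
      (P.withDensity fun ω => ENNReal.ofReal (φ ω)).trim hm := by
    refine @Measure.ext _ m _ _ fun F hF => ?_
    rw [trim_measurableSet_eq hm hF, trim_measurableSet_eq hm hF,
      Measure.restrict_apply (hm F hF), withDensity_apply _ (hm F hF),
      ← ofReal_integral_eq_lintegral_ofReal hint.integrableOn (ae_of_all _ hφ)]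
    have h1 : ∫ ω in F, φ ω ∂P = ∫ ω in F, S.indicator (fun _ => (1 : ℝ)) ω ∂P := by
      rw [← setIntegral_condExp hm ((integrable_const (1 : ℝ)).indicator hS) hF]
      exact setIntegral_congr_ae (hm F hF) (h.mono fun ω hω _ => hω.symm)
    rw [h1, setIntegral_indicator hS]
    simp
  calc ∫⁻ ω in S, U ω ∂P = ∫⁻ ω, U ω ∂((P.restrict S).trim hm) := (lintegral_trim hm hU).symm
    _ = ∫⁻ ω, U ω ∂(P.withDensity fun ω => ENNReal.ofReal (φ ω)) := by
        rw [key, lintegral_trim hm hU]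
    _ = ∫⁻ ω, U ω * ENNReal.ofReal (φ ω) ∂P := by
        rw [lintegral_withDensity_eq_lintegral_mul₀ hmeas (hU.mono hm le_rfl).aemeasurable]
        exact lintegral_congr fun ω => mul_comm _ _

variable {K : ℕ} {X : Type*} [MeasurableSpace X] {μ : Measure X}

/-! ### Moments of the localized importance weights -/

namespace Problem

variable (p : Problem K X μ)

theorem isProbabilityMeasure_G (a : Fin K) : IsProbabilityMeasure (p.G a) :=
  ⟨by rw [G, withDensity_apply _ MeasurableSet.univ, Measure.restrict_univ, p.lintegral_g]⟩

theorem measurable_weight (a : Fin K) : Measurable (p.weight a) :=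
  p.measurable_f.div (p.measurable_g a)

theorem weight_nonneg (a : Fin K) (y : X) : 0 ≤ p.weight a y :=
  div_nonneg (p.f_nonneg y) (p.g_nonneg a y)

/-- The density cancels the denominator where it is positive. Inside the cell its zero set carries
no mass of `f`, so nothing is lost. -/
theorem integral_weight (a : Fin K) : ∫ y, p.weight a y ∂(p.G a) = p.Z a := by
  have h : ∀ y, ENNReal.ofReal (p.g a y) = ((p.g a y).toNNReal : ℝ≥0∞) := fun _ => rfl
  rw [G, Z, ← integral_indicator (p.measurableSet_cell a)]
  simp_rw [h]
  rw [integral_withDensity_eq_integral_smul (p.measurable_g a).real_toNNReal]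
  refine integral_congr_ae ?_
  filter_upwards [p.f_eq_zero_of_g_eq_zero a] with y hy
  rw [NNReal.smul_def, Real.coe_toNNReal _ (p.g_nonneg a y), smul_eq_mul, weight]
  by_cases hc : y ∈ p.cell a
  · rw [Set.indicator_of_mem hc]
    by_cases hg : p.g a y = 0
    · rw [hg, hy hc hg]; simp
    · field_simp
  · rw [Set.indicator_of_notMem hc, p.g_eq_zero_of_notMem a y hc]; simp

theorem lintegral_sq_weight_lt_top {τ : Fin K → ℝ≥0} (hτ : p.SubGaussianWeights τ) (a : Fin K) :
    ∫⁻ y, ENNReal.ofReal (p.weight a y ^ 2) ∂(p.G a) < ∞ := by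
  have := p.isProbabilityMeasure_G a
  have h1 : MemLp (fun y => p.weight a y - ∫ z, p.weight a z ∂(p.G a)) 2 (p.G a) := by
    simpa using (hτ a).memLp 2
  have h2 : MemLp (p.weight a) 2 (p.G a) := by
    convert h1.add (memLp_const (∫ z, p.weight a z ∂(p.G a))) using 1
    funext y
    simp
  exact h2.integrable_sq.lintegral_lt_top

/-- An arm with `τ a = 0` gets no boost and admits no Chernoff parameter `θ ∼ 1 / τ²`, but a
vanishing variance proxy leaves no randomness at all. -/
theorem weight_ae_eq_of_eq_zero {τ : Fin K → ℝ≥0} (hτ : p.SubGaussianWeights τ) {a : Fin K}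
    (ha : τ a = 0) : ∀ᵐ y ∂(p.G a), p.weight a y = p.Z a := by
  have := p.isProbabilityMeasure_G a
  have h := hτ a
  rw [ha] at h
  simp only [ne_eq, OfNat.ofNat_ne_zero, not_false_eq_true, zero_pow] at h
  filter_upwards [h.ae_eq_zero_of_hasSubgaussianMGF_zero] with y hy
  rw [p.integral_weight] at hy
  simpa [sub_eq_zero] using hy

/-- The exponential moment bound in `lintegral` form. -/
theorem lintegral_exp_le {τ : Fin K → ℝ≥0} (hτ : p.SubGaussianWeights τ) (a : Fin K) (θ : ℝ) :
    ∫⁻ y, ENNReal.ofReal (Real.exp (θ * (p.weight a y - p.Z a) - θ ^ 2 * τ a ^ 2 / 2)) ∂(p.G a)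
      ≤ 1 := by
  have h := hτ a
  have h1 := h.mgf_le θ
  have h2 := h.integrable_exp_mul θ
  rw [mgf] at h1
  rw [p.integral_weight] at h1 h2
  simp_rw [sub_eq_add_neg (θ * _), Real.exp_add]
  rw [← ofReal_integral_eq_lintegral_ofReal (h2.mul_const _)
    (ae_of_all _ fun y => by positivity), integral_mul_const, ENNReal.ofReal_le_one]
  calc _ ≤ Real.exp (((τ a ^ 2 : ℝ≥0) : ℝ) * θ ^ 2 / 2) * Real.exp (-(θ ^ 2 * τ a ^ 2 / 2)) := by
        gcongr
    _ = 1 := by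
        rw [← Real.exp_add, Real.exp_eq_one_iff]; push_cast; ring

end Problem

variable {Ω : Type*}

/-- The probability of choosing arm `a` in iteration `t + 1`, initial iterations included. -/
noncomputable def armProb (p : Problem K X μ) (τ : Fin K → ℝ≥0) (A : ℕ → Ω → Fin K)
    (x : ℕ → Ω → X) (t : ℕ) (a : Fin K) (ω : Ω) : ℝ :=
  if t < K then (if t = a then 1 else 0) else proposal p τ A x a (t + 1) ω

/-! ### Elementary facts about boosts, pulls and arm probabilities -/

section Pointwise

variable (p : Problem K X μ) (τ : Fin K → ℝ≥0) (A : ℕ → Ω → Fin K) (x : ℕ → Ω → X)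

theorem estimate_nonneg (a : Fin K) (t : ℕ) (ω : Ω) : 0 ≤ estimate p A x a t ω :=
  div_nonneg (Finset.sum_nonneg fun _ _ => p.weight_nonneg a _) (Nat.cast_nonneg _)

theorem boostConst_nonneg : 0 ≤ boostConst := Real.sqrt_nonneg _

/-- Chernoff's bound at the boost has exponent `(c² / 2) log t`, so this yields tails `t⁻⁵`.
Numerically `c² = 4.14 (1 + 1 / log 2) ≥ 4.14 · 2.42 > 10`. -/
theorem ten_le_boostConst_sq : 10 ≤ boostConst ^ 2 := by
  have h2 : 0 < Real.log 2 := Real.log_pos (by norm_num)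
  have h3 := Real.log_two_lt_d9
  have h1 : Real.logb 2 (2 * Real.exp 1) = 1 + 1 / Real.log 2 := by
    rw [Real.logb, Real.log_mul (by norm_num) (Real.exp_ne_zero _), Real.log_exp]
    field_simp
  have h4 : 1.42 ≤ 1 / Real.log 2 := by
    rw [le_div_iff₀ h2]; linarith
  rw [boostConst, Real.sq_sqrt (by rw [h1]; positivity), h1]
  linarith

theorem boostConst_pos : 0 < boostConst := by
  have := ten_le_boostConst_sq
  refine lt_of_le_of_ne boostConst_nonneg fun h => ?_
  rw [← h] at this
  norm_num at this

theorem boost_nonneg (a : Fin K) (t : ℕ) (ω : Ω) : 0 ≤ boost τ A a t ω :=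
  mul_nonneg (mul_nonneg boostConst_nonneg (τ a).2) (Real.sqrt_nonneg _)

theorem proposal_nonneg (a : Fin K) (t : ℕ) (ω : Ω) : 0 ≤ proposal p τ A x a t ω :=
  div_nonneg (add_nonneg (estimate_nonneg ..) (boost_nonneg ..))
    (Finset.sum_nonneg fun _ _ => add_nonneg (estimate_nonneg ..) (boost_nonneg ..))

theorem armProb_nonneg (t : ℕ) (a : Fin K) (ω : Ω) : 0 ≤ armProb p τ A x t a ω := by
  unfold armProb
  split_ifs
  · exact zero_le_one
  · exact le_rfl
  · exact proposal_nonneg ..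

theorem pulls_succ (a : Fin K) (t : ℕ) (ω : Ω) :
    pulls A a (t + 1) ω = pulls A a t ω + if A (t + 1) ω = a then 1 else 0 := by
  unfold pulls
  simp only [Finset.card_filter]
  rw [Finset.sum_Icc_succ_top (by omega)]

theorem pulls_le (a : Fin K) (t : ℕ) (ω : Ω) : pulls A a t ω ≤ t := by
  refine (Finset.card_filter_le _ _).trans ?_
  simp

end Pointwise

/-! ### Measurability along a run, and integration over one iteration -/

namespace IsRun

variable {mΩ : MeasurableSpace Ω} {p : Problem K X μ} {τ : Fin K → ℝ≥0} {P : Measure Ω}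
  {ℱ : Filtration ℕ mΩ} {A : ℕ → Ω → Fin K} {x : ℕ → Ω → X}

theorem measurable_arm' (hrun : IsRun p τ P ℱ A x) {s t : ℕ} (hs : 1 ≤ s) (hst : s ≤ t) :
    Measurable[ℱ t] (A s) := (hrun.measurable_arm s hs).mono (ℱ.mono hst) le_rfl

theorem measurable_sample' (hrun : IsRun p τ P ℱ A x) {s t : ℕ} (hs : 1 ≤ s) (hst : s ≤ t) :
    Measurable[ℱ t] (x s) := (hrun.measurable_sample s hs).mono (ℱ.mono hst) le_rfl

theorem measurable_pulls (hrun : IsRun p τ P ℱ A x) (a : Fin K) (t : ℕ) :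
    Measurable[ℱ t] (pulls A a t) := by
  have h : pulls A a t = fun ω => ∑ s ∈ Finset.Icc 1 t, if A s ω = a then 1 else 0 := by
    funext ω; rw [pulls, Finset.card_filter]
  rw [h]
  refine Finset.measurable_fun_sum _ fun s hs => ?_
  rw [Finset.mem_Icc] at hs
  exact Measurable.ite (hrun.measurable_arm' hs.1 hs.2 (measurableSet_singleton a))
    measurable_const measurable_const

theorem measurable_estimate (hrun : IsRun p τ P ℱ A x) (a : Fin K) (t : ℕ) :
    Measurable[ℱ t] (estimate p A x a t) := by
  have h : estimate p A x a t = fun ω => (∑ s ∈ Finset.Icc 1 t,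
      if A s ω = a then p.weight a (x s ω) else 0) / (pulls A a t ω : ℝ) := by
    funext ω; rw [estimate, Finset.sum_filter]
  rw [h]
  refine Measurable.div (Finset.measurable_fun_sum _ fun s hs => ?_)
    (measurable_from_top.comp (hrun.measurable_pulls a t))
  rw [Finset.mem_Icc] at hs
  exact Measurable.ite (hrun.measurable_arm' hs.1 hs.2 (measurableSet_singleton a))
    ((p.measurable_weight a).comp (hrun.measurable_sample' hs.1 hs.2)) measurable_const

theorem measurable_boost (hrun : IsRun p τ P ℱ A x) (a : Fin K) (t : ℕ) :
    Measurable[ℱ t] (boost τ A a t) :=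
  measurable_from_top.comp (g := fun n : ℕ =>
    boostConst * (τ a : ℝ) * √(Real.log (t : ℝ) / (n : ℝ))) (hrun.measurable_pulls a t)

theorem measurable_proposal (hrun : IsRun p τ P ℱ A x) (a : Fin K) (t : ℕ) :
    Measurable[ℱ t] (proposal p τ A x a (t + 1)) := by
  have h : ∀ b, Measurable[ℱ t] fun ω => estimate p A x b t ω + boost τ A b t ω := fun b =>
    (hrun.measurable_estimate b t).add (hrun.measurable_boost b t)
  exact (h a).div (Finset.measurable_fun_sum _ fun b _ => h b)

/-- Deterministic initial draws and adaptive draws obey one law in terms of `armProb`, so the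
supermartingale arguments need not separate them. -/
theorem condExp_arm_sample (hrun : IsRun p τ P ℱ A x) (t : ℕ) (a : Fin K)
    {B : Set X} (hB : MeasurableSet B) :
    P[({ω | A (t + 1) ω = a ∧ x (t + 1) ω ∈ B}.indicator fun _ => (1 : ℝ)) | ℱ t]
      =ᵐ[P] fun ω => armProb p τ A x t a ω * (p.G a).real B := by
  unfold armProb
  by_cases ht : t < K
  · simp only [ht, if_true]
    have harm := hrun.init_arm ⟨t, ht⟩
    by_cases hta : t = a
    · obtain rfl : a = ⟨t, ht⟩ := Fin.ext hta.symm
      simp only [if_true, one_mul]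
      refine (condExp_congr_ae (indicator_ae_eq_of_ae_eq_set ?_)).trans
        (hrun.init_sample ⟨t, ht⟩ B hB)
      filter_upwards [harm] with ω hω
      exact propext (and_iff_right hω)
    · simp only [hta, if_false, zero_mul]
      have h0 : ({ω | A (t + 1) ω = a ∧ x (t + 1) ω ∈ B}.indicator fun _ => (1 : ℝ))
          =ᵐ[P] 0 := by
        filter_upwards [harm] with ω hω
        have hω' : A (t + 1) ω ≠ a := fun h => hta (by rw [← h, hω])
        simp [Set.indicator, hω']
      refine (condExp_congr_ae h0).trans ?_
      rw [condExp_zero]; rfl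
  · simp only [ht, if_false]
    exact hrun.step t (not_lt.mp ht) a B hB

theorem measurable_armProb (hrun : IsRun p τ P ℱ A x) (t : ℕ) (a : Fin K) :
    Measurable[ℱ t] (armProb p τ A x t a) := by
  unfold armProb
  by_cases h : t < K
  · simp only [h, if_true]; exact measurable_const
  · simp only [h, if_false]; exact hrun.measurable_proposal a t

theorem one_le_pulls (hrun : IsRun p τ P ℱ A x) : ∀ᵐ ω ∂P, ∀ a t, K ≤ t → 1 ≤ pulls A a t ω := by
  filter_upwards [ae_all_iff.mpr hrun.init_arm] with ω hω a t ht
  exact Finset.card_pos.mpr ⟨a + 1, by simp [hω a]; omega⟩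

variable [IsProbabilityMeasure P]

/-- Under `P` weighted by the past `V` and restricted to one arm, the law of the new sample is a
multiple of that arm's proposal. Taking values in `ℝ≥0∞` avoids integrability questions. -/
theorem lintegral_step (hrun : IsRun p τ P ℱ A x) (t : ℕ) {V : Ω → ℝ≥0∞}
    (hV : Measurable[ℱ t] V) {h : Fin K → X → ℝ≥0∞} (hh : ∀ b, Measurable (h b)) :
    ∫⁻ ω, V ω * h (A (t + 1) ω) (x (t + 1) ω) ∂P =
      ∫⁻ ω, V ω * ∑ b, ENNReal.ofReal (armProb p τ A x t b ω) * ∫⁻ y, h b y ∂(p.G b) ∂P := by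
  have hAm : Measurable (A (t + 1)) := (hrun.measurable_arm (t + 1) (by omega)).mono (ℱ.le _) le_rfl
  have hxm : Measurable (x (t + 1)) :=
    (hrun.measurable_sample (t + 1) (by omega)).mono (ℱ.le _) le_rfl
  have hVm : Measurable V := hV.mono (ℱ.le _) le_rfl
  have hq : ∀ b, Measurable (armProb p τ A x t b) := fun b =>
    (hrun.measurable_armProb t b).mono (ℱ.le _) le_rfl
  have hS : ∀ b : Fin K, MeasurableSet {ω | A (t + 1) ω = b} := fun b =>
    hAm (measurableSet_singleton b)
  have one (b : Fin K) : ∫⁻ ω in {ω | A (t + 1) ω = b}, V ω * h b (x (t + 1) ω) ∂P =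
      ∫⁻ ω, V ω * (ENNReal.ofReal (armProb p τ A x t b ω) * ∫⁻ y, h b y ∂(p.G b)) ∂P := by
    have := p.isProbabilityMeasure_G b
    set c := ∫⁻ ω, V ω * ENNReal.ofReal (armProb p τ A x t b ω) ∂P with hc
    have hmap : Measure.map (x (t + 1)) ((P.withDensity V).restrict {ω | A (t + 1) ω = b}) =
        c • p.G b := by
      ext B hB
      have hSB : MeasurableSet {ω | A (t + 1) ω = b ∧ x (t + 1) ω ∈ B} := (hS b).inter (hxm hB)
      rw [Measure.map_apply hxm hB, Measure.restrict_apply (hxm hB),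
        withDensity_apply _ ((hxm hB).inter (hS b)), Measure.smul_apply, smul_eq_mul]
      have h1 : x (t + 1) ⁻¹' B ∩ {ω | A (t + 1) ω = b} =
          {ω | A (t + 1) ω = b ∧ x (t + 1) ω ∈ B} := by
        ext ω; simp [and_comm]
      rw [h1, setLIntegral_eq_of_condExp (ℱ.le t) hSB
        (fun ω => mul_nonneg (armProb_nonneg ..) measureReal_nonneg)
        (hrun.condExp_arm_sample t b hB) hV, hc, ← lintegral_mul_const _
          (hVm.fun_mul (hq b).ennreal_ofReal)]
      refine lintegral_congr fun ω => ?_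
      rw [ENNReal.ofReal_mul (armProb_nonneg ..), ofReal_measureReal, mul_assoc]
    calc _ = ∫⁻ ω in {ω | A (t + 1) ω = b}, h b (x (t + 1) ω) ∂(P.withDensity V) := by
          rw [restrict_withDensity (hS b),
            lintegral_withDensity_eq_lintegral_mul _ hVm
              (show Measurable fun ω => h b (x (t + 1) ω) from (hh b).comp hxm)]
          rfl
      _ = ∫⁻ y, h b y ∂(c • p.G b) := by rw [← hmap, lintegral_map (hh b) hxm]
      _ = _ := by
          rw [lintegral_smul_measure, hc, smul_eq_mul, ← lintegral_mul_const _
            (hVm.fun_mul (hq b).ennreal_ofReal)]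
          exact lintegral_congr fun ω => mul_assoc _ _ _
  calc _ = ∫⁻ ω, ∑ b, {ω | A (t + 1) ω = b}.indicator
            (fun ω => V ω * h b (x (t + 1) ω)) ω ∂P := by
        refine lintegral_congr fun ω => ?_
        rw [Finset.sum_eq_single (A (t + 1) ω)]
        · simp
        · intro b _ hb; simp [hb.symm]
        · simp
    _ = ∑ b, ∫⁻ ω in {ω | A (t + 1) ω = b}, V ω * h b (x (t + 1) ω) ∂P := by
        rw [lintegral_finsetSum _ fun b _ => (hVm.fun_mul
          (show Measurable fun ω => h b (x (t + 1) ω) from (hh b).comp hxm)).indicator (hS b)]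
        exact Finset.sum_congr rfl fun b _ => lintegral_indicator (hS b) _
    _ = _ := by
        simp_rw [one, Finset.mul_sum]
        rw [lintegral_finsetSum _ fun b _ => hVm.fun_mul ((hq b).ennreal_ofReal.mul_const _)]

/-- Algebra alone does not give this, since the total score could vanish and the quotients would be
`0 / 0 = 0`. It follows because conditional probabilities of a partition add up to one. -/
theorem sum_armProb (hrun : IsRun p τ P ℱ A x) (t : ℕ) :
    ∀ᵐ ω ∂P, ∑ b, armProb p τ A x t b ω = 1 := by
  have h1 : ∀ b, P[({ω | A (t + 1) ω = b}.indicator fun _ => (1 : ℝ)) | ℱ t]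
      =ᵐ[P] fun ω => armProb p τ A x t b ω := fun b => by
    have := p.isProbabilityMeasure_G b
    simpa using hrun.condExp_arm_sample t b MeasurableSet.univ
  have hAm : Measurable (A (t + 1)) := (hrun.measurable_arm (t + 1) (by omega)).mono (ℱ.le _) le_rfl
  have h2 := condExp_finsetSum (μ := P) (s := Finset.univ)
    (f := fun b : Fin K => ({ω | A (t + 1) ω = b}.indicator fun _ => (1 : ℝ)))
    (fun b _ => (integrable_const (1 : ℝ)).indicator (hAm (measurableSet_singleton b))) (ℱ t)
  have h3 : (∑ b : Fin K, ({ω | A (t + 1) ω = b}.indicator fun _ => (1 : ℝ))) = fun _ => 1 := by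
    funext ω
    simp [Finset.sum_apply, Set.indicator]
  rw [h3, condExp_const (ℱ.le t)] at h2
  filter_upwards [h2, ae_all_iff.mpr h1] with ω hω hω1
  rw [Finset.sum_apply] at hω
  rw [hω]
  exact Finset.sum_congr rfl fun b _ => (hω1 b).symm

theorem sum_ofReal_armProb (hrun : IsRun p τ P ℱ A x) (t : ℕ) :
    ∀ᵐ ω ∂P, ∑ b, ENNReal.ofReal (armProb p τ A x t b ω) = 1 := by
  filter_upwards [hrun.sum_armProb t] with ω hω
  rw [← ENNReal.ofReal_sum_of_nonneg fun b _ => armProb_nonneg .., hω, ENNReal.ofReal_one]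

theorem lintegral_mul_le (hrun : IsRun p τ P ℱ A x) (t : ℕ) {V : Ω → ℝ≥0∞}
    (hV : Measurable[ℱ t] V) {h : Fin K → X → ℝ≥0∞} (hh : ∀ b, Measurable (h b)) {c : ℝ≥0∞}
    (hc : ∀ b, ∫⁻ y, h b y ∂(p.G b) ≤ c) :
    ∫⁻ ω, V ω * h (A (t + 1) ω) (x (t + 1) ω) ∂P ≤ (∫⁻ ω, V ω ∂P) * c := by
  rw [hrun.lintegral_step t hV hh, ← lintegral_mul_const _ (hV.mono (ℱ.le _) le_rfl)]
  refine lintegral_mono_ae ?_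
  filter_upwards [hrun.sum_ofReal_armProb t] with ω hω
  gcongr
  calc _ ≤ ∑ b, ENNReal.ofReal (armProb p τ A x t b ω) * c := by gcongr; exact hc _
    _ = c := by rw [← Finset.sum_mul, hω, one_mul]

/-- The product is a nonnegative supermartingale started at 1: whichever arm is drawn, the new
factor has conditional mean at most 1. -/
theorem lintegral_prod_le_one (hrun : IsRun p τ P ℱ A x) {h : Fin K → X → ℝ≥0∞}
    (hh : ∀ b, Measurable (h b)) (hc : ∀ b, ∫⁻ y, h b y ∂(p.G b) ≤ 1) (t : ℕ) :
    ∫⁻ ω, ∏ s ∈ Finset.Icc 1 t, h (A s ω) (x s ω) ∂P ≤ 1 := by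
  induction t with
  | zero => simp
  | succ t ih =>
    simp_rw [Finset.prod_Icc_succ_top (show 1 ≤ t + 1 by omega)]
    refine (hrun.lintegral_mul_le t ?_ hh hc).trans (by simpa using ih)
    refine Finset.measurable_fun_prod _ fun s hs => ?_
    rw [Finset.mem_Icc] at hs
    have : Measurable fun z : Fin K × X => h z.1 z.2 := measurable_from_prod_countable_right hh
    exact this.comp ((hrun.measurable_arm' hs.1 hs.2).prodMk (hrun.measurable_sample' hs.1 hs.2))

theorem ae_sample (hrun : IsRun p τ P ℱ A x) {Q : Fin K → X → Prop}
    (hQ : ∀ b, ∀ᵐ y ∂(p.G b), Q b y) {s : ℕ} (hs : 1 ≤ s) : ∀ᵐ ω ∂P, Q (A s ω) (x s ω) := by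
  obtain ⟨t, rfl⟩ : ∃ t, s = t + 1 := ⟨s - 1, by omega⟩
  have h := hrun.lintegral_mul_le t (V := fun _ => 1) measurable_const
    -- The exceptional sets need not be measurable, so their null measurable hulls are used; the
    -- one-step bound with `c = 0` makes hitting them null.
    (h := fun b => (toMeasurable (p.G b) {y | ¬ Q b y}).indicator 1)
    (fun b => measurable_one.indicator (measurableSet_toMeasurable _ _)) (c := 0) (fun b => by
      rw [lintegral_indicator_one (measurableSet_toMeasurable _ _), measure_toMeasurable]
      exact (ae_iff.mp (hQ b)).le)
  have hm : Measurable fun z : Fin K × X =>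
      (toMeasurable (p.G z.1) {y | ¬ Q z.1 y}).indicator (1 : X → ℝ≥0∞) z.2 :=
    measurable_from_prod_countable_right fun b =>
      measurable_one.indicator (measurableSet_toMeasurable (p.G b) {y | ¬ Q b y})
  have hAm : Measurable (A (t + 1)) := (hrun.measurable_arm (t + 1) (by omega)).mono (ℱ.le _) le_rfl
  have hxm : Measurable (x (t + 1)) :=
    (hrun.measurable_sample (t + 1) (by omega)).mono (ℱ.le _) le_rfl
  simp only [one_mul, mul_zero, nonpos_iff_eq_zero] at h
  filter_upwards [(lintegral_eq_zero_iff (hm.comp (hAm.prodMk hxm))).mp h] with ω hω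
  by_contra hn
  have : x (t + 1) ω ∈ toMeasurable (p.G (A (t + 1) ω)) {y | ¬ Q (A (t + 1) ω) y} :=
    subset_toMeasurable _ _ hn
  simp [this] at hω

end IsRun

end Daisee

namespace Daisee

variable {K : ℕ} {X : Type*} [MeasurableSpace X] {μ : Measure X} {Ω : Type*}

/-! ### Pathwise bounds on estimates, boosts and divergences -/

section Pointwise

variable (p : Problem K X μ) (τ : Fin K → ℝ≥0) (A : ℕ → Ω → Fin K) (x : ℕ → Ω → X)

theorem pulls_mul_estimate (a : Fin K) (t : ℕ) (ω : Ω) :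
    (pulls A a t ω : ℝ) * estimate p A x a t ω =
      ∑ s ∈ (Finset.Icc 1 t).filter fun s => A s ω = a, p.weight a (x s ω) := by
  unfold estimate
  by_cases h : pulls A a t ω = 0
  · rw [h]
    rw [pulls, Finset.card_eq_zero] at h
    simp [h]
  · field_simp

/-- Expresses the exponential supermartingale through the pull count and the estimate, the
quantities the algorithm uses. -/
theorem prod_exp_weight (a : Fin K) (θ v : ℝ) (t : ℕ) (ω : Ω) :
    ∏ s ∈ Finset.Icc 1 t, (if A s ω = a then
        ENNReal.ofReal (Real.exp (θ * (p.weight a (x s ω) - p.Z a) - v)) else 1) =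
      ENNReal.ofReal (Real.exp (pulls A a t ω * (θ * (estimate p A x a t ω - p.Z a) - v))) := by
  rw [← Finset.prod_filter, ← ENNReal.ofReal_prod_of_nonneg fun _ _ => (Real.exp_pos _).le,
    ← Real.exp_sum]
  congr 2
  have h := pulls_mul_estimate p A x a t ω
  rw [Finset.sum_sub_distrib, ← Finset.mul_sum, Finset.sum_sub_distrib, ← h]
  simp only [Finset.sum_const, nsmul_eq_mul]
  rw [pulls]
  ring

theorem boost_le (a : Fin K) (t : ℕ) (ω : Ω) :
    boost τ A a t ω ≤ boostConst * τ a * √(Real.log t) := by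
  unfold boost
  refine mul_le_mul_of_nonneg_left (Real.sqrt_le_sqrt ?_)
    (mul_nonneg boostConst_nonneg (τ a).2)
  -- For an unpulled arm the quotient by zero is 0, so the bound needs no lower bound on pulls.
  rcases Nat.eq_zero_or_pos (pulls A a t ω) with h | h
  · rw [h]; simpa using Real.log_natCast_nonneg t
  · exact div_le_self (Real.log_natCast_nonneg t) (by exact_mod_cast h)

/-- The sum of all importance weights observed up to iteration `t`. -/
noncomputable def totalWeight (t : ℕ) (ω : Ω) : ℝ :=
  ∑ s ∈ Finset.Icc 1 t, p.weight (A s ω) (x s ω)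

theorem totalWeight_nonneg (t : ℕ) (ω : Ω) : 0 ≤ totalWeight p A x t ω :=
  Finset.sum_nonneg fun _ _ => p.weight_nonneg _ _

theorem sum_estimate_le (t : ℕ) (ω : Ω) :
    ∑ a, estimate p A x a t ω ≤ totalWeight p A x t ω := by
  rw [totalWeight, ← Finset.sum_fiberwise (Finset.Icc 1 t) (fun s => A s ω)]
  refine Finset.sum_le_sum fun a _ => ?_
  have h0 : 0 ≤ ∑ s ∈ (Finset.Icc 1 t).filter fun s => A s ω = a, p.weight a (x s ω) :=
    Finset.sum_nonneg fun _ _ => p.weight_nonneg _ _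
  have h1 : ∑ s ∈ (Finset.Icc 1 t).filter (fun s => A s ω = a), p.weight (A s ω) (x s ω) =
      ∑ s ∈ (Finset.Icc 1 t).filter fun s => A s ω = a, p.weight a (x s ω) :=
    Finset.sum_congr rfl fun s hs => by rw [(Finset.mem_filter.mp hs).2]
  rw [h1, estimate]
  rcases Nat.eq_zero_or_pos (pulls A a t ω) with h | h
  · rw [h]; simpa using h0
  · exact div_le_self h0 (by exact_mod_cast h)

end Pointwise

/-- Bounds on the divergence from `π` to the normalisation of positive scores `V`. -/
theorem sum_mul_log_div_nonneg {ι : Type*} [Fintype ι] {w V : ι → ℝ} (hw : ∀ a, 0 < w a)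
    (hw1 : ∑ a, w a = 1) (hV : ∀ a, 0 < V a) :
    0 ≤ ∑ a, w a * Real.log (w a / (V a / ∑ b, V b)) := by
  have hne : Nonempty ι := by
    by_contra h
    rw [not_nonempty_iff] at h
    simp at hw1
  have hS : 0 < ∑ b, V b := Finset.sum_pos (fun b _ => hV b) Finset.univ_nonempty
  have h : ∀ a, w a - V a / ∑ b, V b ≤ w a * Real.log (w a / (V a / ∑ b, V b)) := fun a => by
    have hq : 0 < V a / ∑ b, V b := div_pos (hV a) hS
    have := Real.one_sub_inv_le_log_of_pos (div_pos (hw a) hq)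
    calc w a - V a / ∑ b, V b = w a * (1 - (w a / (V a / ∑ b, V b))⁻¹) := by
          have := (hw a).ne'
          rw [inv_div]; field_simp
      _ ≤ _ := mul_le_mul_of_nonneg_left this (hw a).le
  calc (0 : ℝ) = ∑ a, (w a - V a / ∑ b, V b) := by
        rw [Finset.sum_sub_distrib, hw1, ← Finset.sum_div, div_self hS.ne', sub_self]
    _ ≤ _ := Finset.sum_le_sum fun a _ => h a

/-- A crude bound for the exceptional event: the logarithm splits into `log w ≤ 0`, `log (1 / V)`
and `log (∑ V)`, and `log y ≤ y` bounds the last two. -/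
theorem sum_mul_log_div_le {ι : Type*} [Fintype ι] {w V : ι → ℝ} (hw : ∀ a, 0 < w a)
    (hw1 : ∑ a, w a = 1) (hV : ∀ a, 0 < V a) :
    ∑ a, w a * Real.log (w a / (V a / ∑ b, V b)) ≤ ∑ a, 1 / V a + ∑ b, V b := by
  have hle : ∀ a, w a ≤ 1 := fun a =>
    hw1 ▸ Finset.single_le_sum (fun b _ => (hw b).le) (Finset.mem_univ a)
  have h : ∀ a, w a * Real.log (w a / (V a / ∑ b, V b)) ≤ 1 / V a + w a * ∑ b, V b := fun a => by
    have hS : 0 < ∑ b, V b := Finset.sum_pos (fun b _ => hV b) ⟨a, Finset.mem_univ a⟩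
    have h1 : Real.log (w a / (V a / ∑ b, V b)) =
        Real.log (w a) + Real.log (1 / V a) + Real.log (∑ b, V b) := by
      have := (hV a).ne'
      rw [← Real.log_mul (hw a).ne' (by positivity), ← Real.log_mul
        (mul_ne_zero (hw a).ne' (by positivity)) hS.ne']
      congr 1
      field_simp
    have h2 := Real.log_nonpos (hw a).le (hle a)
    have h3 := Real.log_le_self (one_div_pos.mpr (hV a)).le
    have h4 := Real.log_le_self hS.le
    have h5 : 0 < 1 / V a := one_div_pos.mpr (hV a)
    calc _ ≤ w a * (1 / V a + ∑ b, V b) := by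
          rw [h1]; exact mul_le_mul_of_nonneg_left (by linarith) (hw a).le
      _ = w a * (1 / V a) + w a * ∑ b, V b := mul_add _ _ _
      _ ≤ _ := by gcongr; exact mul_le_of_le_one_left h5.le (hle a)
  calc _ ≤ ∑ a, (1 / V a + w a * ∑ b, V b) := Finset.sum_le_sum fun a _ => h a
    _ = _ := by rw [Finset.sum_add_distrib, ← Finset.sum_mul, hw1, one_mul]

/-- Optimism makes `e + σ` dominate `z`, so normalisation alone can push `q` below `π`, and every
ratio is at most `∑ (e + σ) / ∑ z`. Averaging with weights `π` keeps the common bound. -/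
theorem sum_mul_log_div_le_of_close {ι : Type*} [Fintype ι] [Nonempty ι] {z e σ : ι → ℝ}
    (hz : ∀ a, 0 < z a) (hσ : ∀ a, |e a - z a| ≤ σ a) :
    ∑ a, (z a / ∑ b, z b) * Real.log ((z a / ∑ b, z b) / ((e a + σ a) / ∑ b, (e b + σ b))) ≤
      2 * (∑ b, σ b) / ∑ b, z b := by
  have hZ : 0 < ∑ b, z b := Finset.sum_pos (fun b _ => hz b) Finset.univ_nonempty
  have hV : ∀ a, z a ≤ e a + σ a := fun a => by linarith [(abs_le.mp (hσ a)).1]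
  have hS : 0 < ∑ b, (e b + σ b) :=
    Finset.sum_pos (fun b _ => (hz b).trans_le (hV b)) Finset.univ_nonempty
  have hS' : ∑ b, (e b + σ b) ≤ ∑ b, z b + 2 * ∑ b, σ b := by
    rw [Finset.mul_sum, ← Finset.sum_add_distrib]
    exact Finset.sum_le_sum fun b _ => by linarith [(abs_le.mp (hσ b)).2]
  have h : ∀ a, Real.log ((z a / ∑ b, z b) / ((e a + σ a) / ∑ b, (e b + σ b))) ≤
      2 * (∑ b, σ b) / ∑ b, z b := fun a => by
    have hza := hz a
    have hVa := (hz a).trans_le (hV a)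
    have h1 : (z a / ∑ b, z b) / ((e a + σ a) / ∑ b, (e b + σ b)) ≤
        (∑ b, (e b + σ b)) / ∑ b, z b := by
      rw [div_div_div_eq, div_le_div_iff₀ (by positivity) hZ]
      have := mul_le_mul_of_nonneg_right (hV a) (mul_pos hS hZ).le
      nlinarith
    have h2 := Real.log_le_sub_one_of_pos (x := (z a / ∑ b, z b) / ((e a + σ a) /
      ∑ b, (e b + σ b))) (by positivity)
    have h3 : (∑ b, (e b + σ b)) / ∑ b, z b ≤ 1 + 2 * (∑ b, σ b) / ∑ b, z b := by
      rw [div_le_iff₀ hZ, add_mul, div_mul_cancel₀ _ hZ.ne', one_mul]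
      exact hS'
    linarith
  calc _ ≤ ∑ a, (z a / ∑ b, z b) * (2 * (∑ b, σ b) / ∑ b, z b) :=
        Finset.sum_le_sum fun a _ =>
          mul_le_mul_of_nonneg_left (h a) (div_pos (hz a) hZ).le
    _ = _ := by rw [← Finset.sum_mul, ← Finset.sum_div, div_self hZ.ne', one_mul]

/-! ### Concentration of estimates and pull counts; crude moment bounds -/

namespace IsRun

variable {mΩ : MeasurableSpace Ω} {p : Problem K X μ} {τ : Fin K → ℝ≥0} {P : Measure Ω}
  {ℱ : Filtration ℕ mΩ} {A : ℕ → Ω → Fin K} {x : ℕ → Ω → X}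

theorem measurable_totalWeight (hrun : IsRun p τ P ℱ A x) (t : ℕ) :
    Measurable (totalWeight p A x t) := by
  refine Finset.measurable_fun_sum _ fun s hs => ?_
  rw [Finset.mem_Icc] at hs
  have : Measurable fun z : Fin K × X => p.weight z.1 z.2 :=
    measurable_from_prod_countable_right p.measurable_weight
  exact this.comp (((hrun.measurable_arm s hs.1).mono (ℱ.le _) le_rfl).prodMk
    ((hrun.measurable_sample s hs.1).mono (ℱ.le _) le_rfl))

variable [IsProbabilityMeasure P]

theorem estimate_eq_of_eq_zero (hrun : IsRun p τ P ℱ A x) (hτ : p.SubGaussianWeights τ)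
    {a : Fin K} (ha : τ a = 0) : ∀ᵐ ω ∂P, ∀ t, K ≤ t → estimate p A x a t ω = p.Z a := by
  have h : ∀ᵐ ω ∂P, ∀ s, 1 ≤ s → A s ω = a → p.weight a (x s ω) = p.Z a := by
    refine ae_all_iff.mpr fun s => ?_
    by_cases hs : 1 ≤ s
    · simp only [hs, true_imp_iff]
      have := hrun.ae_sample (Q := fun b y => b = a → p.weight a y = p.Z a) (fun b => by
        by_cases hb : b = a
        · subst hb; simpa using p.weight_ae_eq_of_eq_zero hτ ha
        · simp [hb]) hs
      exact this
    · simp [hs]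
  filter_upwards [h, hrun.one_le_pulls] with ω hω hN t ht
  have hN' : (pulls A a t ω : ℝ) ≠ 0 := by have := hN a t ht; positivity
  refine mul_left_cancel₀ hN' ?_
  rw [pulls_mul_estimate]
  calc _ = ∑ s ∈ (Finset.Icc 1 t).filter fun s => A s ω = a, p.Z a :=
        Finset.sum_congr rfl fun s hs => by
          rw [Finset.mem_filter, Finset.mem_Icc] at hs
          exact hω s hs.1.1 hs.2
    _ = _ := by rw [Finset.sum_const, nsmul_eq_mul, pulls]

/-- Markov's inequality for the exponential supermartingale of arm `a`, in which draws of other arms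
contribute the factor 1. -/
theorem measure_exp_tail_le (hrun : IsRun p τ P ℱ A x) (hτ : p.SubGaussianWeights τ) (a : Fin K)
    (t : ℕ) (θ c : ℝ) :
    P {ω | c ≤ pulls A a t ω * (θ * (estimate p A x a t ω - p.Z a) - θ ^ 2 * τ a ^ 2 / 2)} ≤
      ENNReal.ofReal (Real.exp (-c)) := by
  have hint := hrun.lintegral_prod_le_one
    (h := fun b y => if b = a then ENNReal.ofReal
      (Real.exp (θ * (p.weight a y - p.Z a) - θ ^ 2 * τ a ^ 2 / 2)) else 1)
    (fun b => by
      by_cases hb : b = a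
      · simp only [hb, if_true]
        have := p.measurable_weight a
        fun_prop
      · simp only [hb, if_false]; exact measurable_const)
    (fun b => by
      have := p.isProbabilityMeasure_G b
      by_cases hb : b = a
      · subst hb; simpa using p.lintegral_exp_le hτ b θ
      · simp [hb]) t
  simp_rw [prod_exp_weight] at hint
  have hm : Measurable fun ω => ENNReal.ofReal (Real.exp (pulls A a t ω *
      (θ * (estimate p A x a t ω - p.Z a) - θ ^ 2 * τ a ^ 2 / 2))) := by
    have h1 : Measurable (estimate p A x a t) :=
      (hrun.measurable_estimate a t).mono (ℱ.le t) le_rfl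
    have h2 : Measurable fun ω => (pulls A a t ω : ℝ) :=
      measurable_from_top.comp ((hrun.measurable_pulls a t).mono (ℱ.le t) le_rfl)
    fun_prop
  have hmarkov := mul_meas_ge_le_lintegral₀ (μ := P) hm.aemeasurable
    (ENNReal.ofReal (Real.exp c))
  have hset : {ω | c ≤ pulls A a t ω *
      (θ * (estimate p A x a t ω - p.Z a) - θ ^ 2 * τ a ^ 2 / 2)} ⊆
      {ω | ENNReal.ofReal (Real.exp c) ≤ ENNReal.ofReal (Real.exp (pulls A a t ω *
        (θ * (estimate p A x a t ω - p.Z a) - θ ^ 2 * τ a ^ 2 / 2)))} := fun ω hω =>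
    ENNReal.ofReal_le_ofReal (Real.exp_le_exp.mpr hω)
  rw [Real.exp_neg, ENNReal.ofReal_inv_of_pos (Real.exp_pos c), ← ENNReal.div_eq_inv_mul.trans
    (mul_one _), ENNReal.le_div_iff_mul_le (Or.inl (by simp [Real.exp_pos])) (Or.inl (by simp)),
    mul_comm]
  exact (mul_le_mul_right (measure_mono hset) _).trans (hmarkov.trans hint)

theorem measure_signed_deviation_le (hrun : IsRun p τ P ℱ A x) (hτ : p.SubGaussianWeights τ)
    {a : Fin K} (ha : τ a ≠ 0) {t n : ℕ} (ht : 1 ≤ t) (hn : 1 ≤ n) {u : ℝ} (hu : u ^ 2 = 1) :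
    P {ω | pulls A a t ω = n ∧ boost τ A a t ω < u * (estimate p A x a t ω - p.Z a)} ≤
      ENNReal.ofReal (1 / (t : ℝ) ^ 5) := by
  have hτ0 : (0 : ℝ) < τ a := by
    have := pos_iff_ne_zero.mpr ha
    exact_mod_cast this
  have hn0 : (0 : ℝ) < n := by exact_mod_cast hn
  have ht0 : (0 : ℝ) < t := by exact_mod_cast ht
  have hlog : 0 ≤ Real.log t := Real.log_natCast_nonneg t
  set ε := boostConst * (τ a : ℝ) * √(Real.log (t : ℝ) / (n : ℝ)) with hε
  have hε0 : 0 ≤ ε := by have := boostConst_nonneg; positivity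
  have hε2 : n * ε ^ 2 = boostConst ^ 2 * τ a ^ 2 * Real.log t := by
    rw [hε, mul_pow, mul_pow, Real.sq_sqrt (by positivity)]; field_simp
  -- Once the pull count is fixed at `n`, the boost is the constant `ε`, so the optimal Chernoff
  -- parameter `ε / τ²`, with sign `u`, is deterministic. The exponent is then `n ε² / (2 τ²) = (c²
  -- / 2) log t ≥ 5 log t`.
  have h := hrun.measure_exp_tail_le hτ a t (u * ε / τ a ^ 2) (5 * Real.log t)
  have hexp : Real.exp (-(5 * Real.log t)) = 1 / (t : ℝ) ^ 5 := by
    rw [Real.exp_neg, mul_comm, Real.exp_mul, Real.exp_log ht0, one_div]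
    norm_cast
  rw [hexp] at h
  refine (measure_mono ?_).trans h
  rintro ω ⟨hN, hdev⟩
  simp only [boost, hN] at hdev
  rw [← hε] at hdev
  show 5 * Real.log t ≤ _
  rw [hN]
  set d := estimate p A x a t ω - p.Z a
  have h1 : (u * ε / τ a ^ 2) * d - (u * ε / τ a ^ 2) ^ 2 * τ a ^ 2 / 2 =
      (ε * (u * d) - ε ^ 2 / 2) / τ a ^ 2 := by
    field_simp
    linear_combination (-(ε ^ 2)) * hu
  have h2 : ε ^ 2 / 2 ≤ ε * (u * d) - ε ^ 2 / 2 := by nlinarith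
  calc 5 * Real.log t ≤ boostConst ^ 2 / 2 * Real.log t := by
        have := ten_le_boostConst_sq
        gcongr; linarith
    _ = n * ((ε ^ 2 / 2) / τ a ^ 2) := by
        rw [show n * (ε ^ 2 / 2 / (τ a : ℝ) ^ 2) = n * ε ^ 2 / 2 / τ a ^ 2 by ring, hε2]
        field_simp
    _ ≤ _ := by rw [h1]; gcongr

/-- The pull count is random, so a union over its at most `t` values costs one power of `t`; the two
signs give the factor 2. If `τ a = 0` the estimate is exact. -/
theorem measure_deviation_le (hrun : IsRun p τ P ℱ A x) (hτ : p.SubGaussianWeights τ)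
    (a : Fin K) {t : ℕ} (hK : K ≤ t) (ht : 1 ≤ t) :
    P {ω | ¬ |estimate p A x a t ω - p.Z a| ≤ boost τ A a t ω} ≤
      ENNReal.ofReal (2 / (t : ℝ) ^ 4) := by
  by_cases ha : τ a = 0
  · refine le_trans (le_of_eq ?_) zero_le
    rw [← ae_iff]
    filter_upwards [hrun.estimate_eq_of_eq_zero hτ ha] with ω hω
    rw [hω t hK, sub_self, abs_zero]
    exact boost_nonneg ..
  · have hsub : {ω | ¬ |estimate p A x a t ω - p.Z a| ≤ boost τ A a t ω} ≤ᵐ[P]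
        ⋃ n ∈ Finset.Icc 1 t,
          ({ω | pulls A a t ω = n ∧ boost τ A a t ω < 1 * (estimate p A x a t ω - p.Z a)} ∪
          {ω | pulls A a t ω = n ∧ boost τ A a t ω < -1 * (estimate p A x a t ω - p.Z a)}) := by
      filter_upwards [hrun.one_le_pulls] with ω hN hω
      have hω' : ¬ |estimate p A x a t ω - p.Z a| ≤ boost τ A a t ω := hω
      rw [not_le, lt_abs] at hω'
      refine Set.mem_biUnion (x := pulls A a t ω)
        (Finset.mem_coe.mpr (Finset.mem_Icc.mpr ⟨hN a t hK, pulls_le A a t ω⟩)) ?_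
      rcases hω' with h | h
      · exact Or.inl ⟨rfl, by linarith⟩
      · exact Or.inr ⟨rfl, by linarith⟩
    have ht0 : (0 : ℝ) < t := by exact_mod_cast ht
    calc _ ≤ _ := measure_mono_ae hsub
      _ ≤ ∑ n ∈ Finset.Icc 1 t, _ := measure_biUnion_finset_le _ _
      _ ≤ ∑ n ∈ Finset.Icc 1 t, ENNReal.ofReal (2 / (t : ℝ) ^ 5) := by
          refine Finset.sum_le_sum fun n hn => (measure_union_le _ _).trans ?_
          have hn1 := (Finset.mem_Icc.mp hn).1
          refine (add_le_add (hrun.measure_signed_deviation_le hτ ha ht hn1 (by norm_num))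
            (hrun.measure_signed_deviation_le hτ ha ht hn1 (by norm_num))).trans ?_
          rw [← ENNReal.ofReal_add (by positivity) (by positivity)]
          exact ENNReal.ofReal_le_ofReal (le_of_eq (by ring))
      _ = ENNReal.ofReal (2 / (t : ℝ) ^ 4) := by
          rw [Finset.sum_const, nsmul_eq_mul, Nat.card_Icc, Nat.add_sub_cancel,
            ← ENNReal.ofReal_natCast, ← ENNReal.ofReal_mul (by positivity)]
          congr 1
          field_simp

/-- If arm `a` has probability at least `η` in each of `k` consecutive iterations, it is unlikely
to be chosen rarely. -/
theorem measure_pulls_lt_le (hrun : IsRun p τ P ℱ A x) (a : Fin K) {η : ℝ} (hη : 0 ≤ η)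
    (hη1 : η ≤ 1) (m k : ℕ) (y : ℝ) :
    P {ω | (∀ i < k, η ≤ armProb p τ A x (m + i) a ω) ∧ pulls A a (m + k) ω < y} ≤
      ENNReal.ofReal (Real.exp (y - η * k / 2)) := by
  set c : Fin K → ℝ := fun b => if b = a then Real.exp (-1) else 1 with hc
  -- A Chernoff product with parameter `-1` that is killed once the probability of `a` falls below
  -- `η`. The indicator is known before the draw, so each factor has conditional mean at most `1 -
  -- (1 - 1/e) η ≤ 1 - η / 2`.
  set U : ℕ → Ω → ℝ≥0∞ := fun k ω => ∏ i ∈ Finset.range k,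
    ({ω | η ≤ armProb p τ A x (m + i) a ω}.indicator (fun _ => 1) ω *
      ENNReal.ofReal (c (A (m + i + 1) ω))) with hU
  have hHm : ∀ i, MeasurableSet[ℱ (m + i)] {ω | η ≤ armProb p τ A x (m + i) a ω} := fun i =>
    hrun.measurable_armProb (m + i) a measurableSet_Ici
  have hUm : ∀ k, Measurable[ℱ (m + k)] (U k) := fun k => by
    refine Finset.measurable_fun_prod _ fun i hi => ?_
    have hik := Finset.mem_range.mp hi
    refine Measurable.mul ?_ ?_
    · exact (measurable_const.indicator (hHm i)).mono (ℱ.mono (by omega)) le_rfl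
    · exact (measurable_from_top (f := fun b : Fin K => ENNReal.ofReal (c b))).comp
        (hrun.measurable_arm' (by omega) (by omega))
  have hexp1 : Real.exp (-1) ≤ 1 / 2 := by
    have := Real.add_one_le_exp 1
    rw [Real.exp_neg, ← one_div]
    exact one_div_le_one_div_of_le (by norm_num) (by linarith)
  have hc0 : ∀ b, 0 ≤ c b := fun b => by
    simp only [hc]; split_ifs <;> positivity
  have hint : ∀ k, ∫⁻ ω, U k ω ∂P ≤ ENNReal.ofReal (1 - η / 2) ^ k := by
    intro k
    induction k with
    | zero => simp [hU]
    | succ k ih =>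
      have hsucc : ∀ ω, U (k + 1) ω =
          (U k ω * {ω | η ≤ armProb p τ A x (m + k) a ω}.indicator (fun _ => 1) ω) *
            ENNReal.ofReal (c (A (m + k + 1) ω)) := fun ω => by
        simp only [hU, Finset.prod_range_succ, mul_assoc]
      have hVm : Measurable[ℱ (m + k)] fun ω => U k ω *
          {ω | η ≤ armProb p τ A x (m + k) a ω}.indicator (fun _ => 1) ω :=
        (hUm k).mul (measurable_const.indicator (hHm k))
      simp_rw [hsucc]
      rw [pow_succ]
      calc _ = _ := hrun.lintegral_step (m + k) hVm (h := fun b _ => ENNReal.ofReal (c b))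
            fun b => measurable_const
        _ ≤ ∫⁻ ω, U k ω * ENNReal.ofReal (1 - η / 2) ∂P := by
            refine lintegral_mono_ae ?_
            filter_upwards [hrun.sum_armProb (m + k)] with ω hω
            by_cases hH : η ≤ armProb p τ A x (m + k) a ω
            · rw [Set.indicator_of_mem (show ω ∈ {ω | η ≤ armProb p τ A x (m + k) a ω} from hH),
                mul_one]
              gcongr
              have h1 : ∀ b, ENNReal.ofReal (armProb p τ A x (m + k) b ω) *
                  ∫⁻ _, ENNReal.ofReal (c b) ∂(p.G b) =
                  ENNReal.ofReal (armProb p τ A x (m + k) b ω * c b) := fun b => by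
                have := p.isProbabilityMeasure_G b
                rw [lintegral_const, measure_univ, mul_one,
                  ENNReal.ofReal_mul (armProb_nonneg ..)]
              simp_rw [h1]
              rw [← ENNReal.ofReal_sum_of_nonneg fun b _ =>
                mul_nonneg (armProb_nonneg ..) (hc0 b)]
              refine ENNReal.ofReal_le_ofReal ?_
              have h2 : ∑ b, armProb p τ A x (m + k) b ω * c b =
                  1 - (1 - Real.exp (-1)) * armProb p τ A x (m + k) a ω := by
                have h3 : ∀ b, armProb p τ A x (m + k) b ω * c b =
                    armProb p τ A x (m + k) b ω - if b = a then
                      (1 - Real.exp (-1)) * armProb p τ A x (m + k) a ω else 0 := fun b => by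
                  simp only [hc]
                  split_ifs with hb
                  · subst hb; ring
                  · ring
                simp_rw [h3]
                rw [Finset.sum_sub_distrib, hω]
                simp
              rw [h2]
              nlinarith
            · rw [Set.indicator_of_notMem
                (show ω ∉ {ω | η ≤ armProb p τ A x (m + k) a ω} from hH)]
              simp
        _ = (∫⁻ ω, U k ω ∂P) * ENNReal.ofReal (1 - η / 2) :=
            lintegral_mul_const _ ((hUm k).mono (ℱ.le _) le_rfl)
        _ ≤ _ := by gcongr
  -- Pulls up to time `m` only decrease the left side, so they may be counted as well.
  have hlow : ∀ ω k, (∀ i < k, η ≤ armProb p τ A x (m + i) a ω) →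
      ENNReal.ofReal (Real.exp (-(pulls A a (m + k) ω : ℝ))) ≤ U k ω := by
    intro ω k
    induction k with
    | zero => intro _; simp [hU]
    | succ k ih =>
      intro hH
      have h1 := ih fun i hi => hH i (by omega)
      have h2 : U (k + 1) ω = U k ω * ENNReal.ofReal (c (A (m + k + 1) ω)) := by
        simp only [hU, Finset.prod_range_succ]
        rw [Set.indicator_of_mem
          (show ω ∈ {ω | η ≤ armProb p τ A x (m + k) a ω} from hH k (by omega)), one_mul]
      have h3 : Real.exp (-(pulls A a (m + (k + 1)) ω : ℝ)) =
          Real.exp (-(pulls A a (m + k) ω : ℝ)) * c (A (m + k + 1) ω) := by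
        rw [← add_assoc, pulls_succ]
        simp only [hc]
        split_ifs
        · rw [← Real.exp_add]; push_cast; ring_nf
        · simp
      rw [h2, h3, ENNReal.ofReal_mul (Real.exp_pos _).le]
      gcongr
  have hmarkov := mul_meas_ge_le_lintegral₀ (μ := P) ((hUm k).mono (ℱ.le _) le_rfl).aemeasurable
    (ENNReal.ofReal (Real.exp (-y)))
  have hset : {ω | (∀ i < k, η ≤ armProb p τ A x (m + i) a ω) ∧ pulls A a (m + k) ω < y} ⊆
      {ω | ENNReal.ofReal (Real.exp (-y)) ≤ U k ω} := fun ω hω =>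
    (ENNReal.ofReal_le_ofReal (Real.exp_le_exp.mpr (by linarith [hω.2]))).trans (hlow ω k hω.1)
  have hpow : ENNReal.ofReal (1 - η / 2) ^ k ≤ ENNReal.ofReal (Real.exp (-(η * k / 2))) := by
    rw [← ENNReal.ofReal_pow (by linarith)]
    refine ENNReal.ofReal_le_ofReal ?_
    calc (1 - η / 2) ^ k ≤ Real.exp (-(η / 2)) ^ k :=
          pow_le_pow_left₀ (by linarith) (by linarith [Real.add_one_le_exp (-(η / 2))]) k
      _ = _ := by rw [← Real.exp_nat_mul]; ring_nf
  have hfin : ENNReal.ofReal (Real.exp (-y)) *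
      P {ω | (∀ i < k, η ≤ armProb p τ A x (m + i) a ω) ∧ pulls A a (m + k) ω < y} ≤
        ENNReal.ofReal (Real.exp (-(η * k / 2))) :=
    (mul_le_mul_right (measure_mono hset) _).trans (hmarkov.trans ((hint k).trans hpow))
  calc _ = ENNReal.ofReal (Real.exp y) * (ENNReal.ofReal (Real.exp (-y)) * P {ω |
        (∀ i < k, η ≤ armProb p τ A x (m + i) a ω) ∧ pulls A a (m + k) ω < y}) := by
        rw [← mul_assoc, ← ENNReal.ofReal_mul (Real.exp_pos _).le, ← Real.exp_add]
        simp
    _ ≤ ENNReal.ofReal (Real.exp y) * ENNReal.ofReal (Real.exp (-(η * k / 2))) := by gcongr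
    _ = _ := by
        rw [← ENNReal.ofReal_mul (Real.exp_pos _).le, ← Real.exp_add, sub_eq_add_neg]

/-- The weights are dependent, but Cauchy–Schwarz with second moments bounded uniformly over the
arms suffices. -/
theorem exists_integral_sq_totalWeight_le (hrun : IsRun p τ P ℱ A x)
    (hτ : p.SubGaussianWeights τ) :
    ∃ M : ℝ, 0 ≤ M ∧ ∀ t, MemLp (totalWeight p A x t) 2 P ∧
      ∫ ω, totalWeight p A x t ω ^ 2 ∂P ≤ M * (t : ℝ) ^ 2 := by
  set m : ℝ≥0∞ := ∑ b, ∫⁻ y, ENNReal.ofReal (p.weight b y ^ 2) ∂(p.G b) with hm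
  have hmtop : m ≠ ∞ := by
    rw [hm, ENNReal.sum_ne_top]
    exact fun b _ => (p.lintegral_sq_weight_lt_top hτ b).ne
  have hsingle : ∀ s, 1 ≤ s →
      ∫⁻ ω, ENNReal.ofReal (p.weight (A s ω) (x s ω) ^ 2) ∂P ≤ m := fun s hs => by
    obtain ⟨t, rfl⟩ : ∃ t, s = t + 1 := ⟨s - 1, by omega⟩
    have := hrun.lintegral_mul_le t (V := fun _ => 1) measurable_const
      (h := fun b y => ENNReal.ofReal (p.weight b y ^ 2))
      (fun b => ((p.measurable_weight b).pow_const 2).ennreal_ofReal) (c := m)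
      (fun b => Finset.single_le_sum
        (f := fun b => ∫⁻ y, ENNReal.ofReal (p.weight b y ^ 2) ∂(p.G b))
        (fun _ _ => zero_le) (Finset.mem_univ b))
    simpa using this
  have hmeas : ∀ s, 1 ≤ s → Measurable fun ω => ENNReal.ofReal (p.weight (A s ω) (x s ω) ^ 2) :=
    fun s hs => by
      have : Measurable fun z : Fin K × X => ENNReal.ofReal (p.weight z.1 z.2 ^ 2) :=
        measurable_from_prod_countable_right
          fun b => ((p.measurable_weight b).pow_const 2).ennreal_ofReal
      exact this.comp (((hrun.measurable_arm s hs).mono (ℱ.le _) le_rfl).prodMk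
        ((hrun.measurable_sample s hs).mono (ℱ.le _) le_rfl))
  have hlin : ∀ t, ∫⁻ ω, ENNReal.ofReal (totalWeight p A x t ω ^ 2) ∂P ≤
      ENNReal.ofReal (m.toReal * (t : ℝ) ^ 2) := fun t => by
    calc _ ≤ ∫⁻ ω, (t : ℝ≥0∞) *
          ∑ s ∈ Finset.Icc 1 t, ENNReal.ofReal (p.weight (A s ω) (x s ω) ^ 2) ∂P := by
          refine lintegral_mono fun ω => ?_
          rw [← ENNReal.ofReal_sum_of_nonneg fun _ _ => sq_nonneg _, ← ENNReal.ofReal_natCast,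
            ← ENNReal.ofReal_mul (by positivity)]
          refine ENNReal.ofReal_le_ofReal ?_
          simpa [totalWeight] using sq_sum_le_card_mul_sum_sq (s := Finset.Icc 1 t)
            (f := fun s => p.weight (A s ω) (x s ω))
      _ = (t : ℝ≥0∞) * ∑ s ∈ Finset.Icc 1 t,
          ∫⁻ ω, ENNReal.ofReal (p.weight (A s ω) (x s ω) ^ 2) ∂P := by
          rw [lintegral_const_mul _ (Finset.measurable_fun_sum _ fun s hs =>
            hmeas s (Finset.mem_Icc.mp hs).1), lintegral_finsetSum' _ fun s hs =>
            (hmeas s (Finset.mem_Icc.mp hs).1).aemeasurable]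
      _ ≤ (t : ℝ≥0∞) * ∑ s ∈ Finset.Icc 1 t, m := by
          gcongr with s hs
          exact hsingle s (Finset.mem_Icc.mp hs).1
      _ = _ := by
          rw [Finset.sum_const, nsmul_eq_mul, Nat.card_Icc, Nat.add_sub_cancel,
            ENNReal.ofReal_mul ENNReal.toReal_nonneg, ENNReal.ofReal_toReal hmtop,
            ENNReal.ofReal_pow (by positivity), ENNReal.ofReal_natCast]
          ring
  refine ⟨m.toReal, ENNReal.toReal_nonneg, fun t => ⟨?_, ?_⟩⟩
  · rw [memLp_two_iff_integrable_sq (hrun.measurable_totalWeight t).aestronglyMeasurable]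
    refine ⟨((hrun.measurable_totalWeight t).pow_const 2).aestronglyMeasurable, ?_⟩
    rw [hasFiniteIntegral_iff_ofReal (ae_of_all _ fun _ => sq_nonneg _)]
    exact (hlin t).trans_lt ENNReal.ofReal_lt_top
  · rw [integral_eq_lintegral_of_nonneg_ae (ae_of_all _ fun _ => sq_nonneg _)
      ((hrun.measurable_totalWeight t).pow_const 2).aestronglyMeasurable]
    exact ENNReal.toReal_le_of_le_ofReal (by positivity) (hlin t)

/-- A floor valid outside the good event too: an arm with `τ a = 0` has an exact estimate, and any
other has a boost of at least `c τ √(log 2 / t)`. The boost is zero at `t = 1`, hence `2 ≤ t`. -/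
theorem exists_le_score (hrun : IsRun p τ P ℱ A x) (hτ : p.SubGaussianWeights τ)
    (hZ : ∀ a, 0 < p.Z a) (a : Fin K) :
    ∃ κ : ℝ, 0 < κ ∧ ∀ᵐ ω ∂P, ∀ t : ℕ, 2 ≤ t → K ≤ t →
      κ / √t ≤ estimate p A x a t ω + boost τ A a t ω := by
  by_cases ha : τ a = 0
  · refine ⟨p.Z a, hZ a, ?_⟩
    filter_upwards [hrun.estimate_eq_of_eq_zero hτ ha] with ω hω t ht hK
    rw [hω t hK]
    have h1 : p.Z a / √t ≤ p.Z a := div_le_self (hZ a).le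
      (Real.one_le_sqrt.mpr (by exact_mod_cast (by omega : 1 ≤ t)))
    have := boost_nonneg τ A a t ω
    linarith
  · have hτ0 : (0 : ℝ) < τ a := by
      have := pos_iff_ne_zero.mpr ha
      exact_mod_cast this
    have hl2 : 0 < Real.log 2 := Real.log_pos (by norm_num)
    refine ⟨boostConst * τ a * √(Real.log 2),
      mul_pos (mul_pos boostConst_pos hτ0) (Real.sqrt_pos.mpr hl2), ?_⟩
    filter_upwards [hrun.one_le_pulls] with ω hN t ht hK
    have h1 : boostConst * τ a * √(Real.log 2) / √t ≤ boost τ A a t ω := by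
      rw [boost, mul_div_assoc, ← Real.sqrt_div hl2.le]
      have hN0 : (0 : ℝ) < pulls A a t ω := by exact_mod_cast hN a t hK
      refine mul_le_mul_of_nonneg_left (Real.sqrt_le_sqrt ?_)
        (mul_nonneg boostConst_nonneg (τ a).2)
      refine div_le_div₀ (Real.log_natCast_nonneg t)
        (Real.log_le_log (by norm_num) (by exact_mod_cast ht)) hN0 ?_
      exact_mod_cast pulls_le A a t ω
    have := estimate_nonneg p A x a t ω
    linarith

end IsRun

end Daisee

namespace Daisee

/-! ### Asymptotic estimates for logarithms and sums -/

theorem eventually_exp_neg_div_sqrt_log_le {κ : ℝ} (hκ : 0 < κ) :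
    ∀ᶠ t : ℕ in atTop, Real.exp (-(κ * (t / √(Real.log t)))) ≤ 1 / (t : ℝ) ^ 3 := by
  have h1 : ∀ᶠ y : ℝ in atTop, Real.log y ^ (3 / 2 : ℝ) ≤ κ / 3 * y ^ (1 : ℝ) := by
    have := (isLittleO_log_rpow_rpow_atTop (3 / 2 : ℝ) one_pos).bound
      (show (0 : ℝ) < κ / 3 by positivity)
    filter_upwards [this, eventually_ge_atTop 1] with y hy hy1
    have hl := Real.log_nonneg hy1
    rwa [Real.norm_of_nonneg (by positivity), Real.norm_of_nonneg (by positivity)] at hy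
  filter_upwards [tendsto_natCast_atTop_atTop.eventually h1, eventually_ge_atTop 3] with t ht ht3
  have ht0 : (0 : ℝ) < t := by positivity
  have hlog : 0 < Real.log t := Real.log_pos (by exact_mod_cast (by omega : 1 < t))
  rw [Real.rpow_one, show (3 / 2 : ℝ) = 1 + 1 / 2 by norm_num, Real.rpow_add hlog, Real.rpow_one,
    ← Real.sqrt_eq_rpow] at ht
  have h2 : 3 * Real.log t ≤ κ * (t / √(Real.log t)) := by
    rw [mul_div_assoc', le_div_iff₀ (Real.sqrt_pos.mpr hlog)]
    linarith
  calc Real.exp (-(κ * (t / √(Real.log t)))) ≤ Real.exp (-(3 * Real.log t)) := by gcongr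
    _ = 1 / (t : ℝ) ^ 3 := by
      rw [Real.exp_neg, mul_comm, Real.exp_mul, Real.exp_log ht0, one_div]
      norm_cast

theorem sum_one_div_sqrt_le (T : ℕ) : ∑ n ∈ Finset.Icc 1 T, 1 / √(n : ℝ) ≤ 2 * √(T : ℝ) := by
  induction T with
  | zero => simp
  | succ T ih =>
    rw [Finset.sum_Icc_succ_top (by omega)]
    have h0 : (0 : ℝ) < √((T + 1 : ℕ) : ℝ) := Real.sqrt_pos.mpr (by positivity)
    have h1 : √(T : ℝ) ^ 2 = T := Real.sq_sqrt (by positivity)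
    have h2 : √((T + 1 : ℕ) : ℝ) ^ 2 = T + 1 := by
      rw [Real.sq_sqrt (by positivity)]; push_cast; ring
    -- Each term is dominated by a telescoping difference.
    have h3 : 1 / √((T + 1 : ℕ) : ℝ) ≤ 2 * √((T + 1 : ℕ) : ℝ) - 2 * √(T : ℝ) := by
      rw [div_le_iff₀ h0]
      nlinarith [sq_nonneg (√((T + 1 : ℕ) : ℝ) - √(T : ℝ))]
    linarith

theorem one_le_log_natCast {n : ℕ} (hn : 3 ≤ n) : 1 ≤ Real.log n := by
  rw [Real.le_log_iff_exp_le (by positivity)]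
  have h : (3 : ℝ) ≤ n := by exact_mod_cast hn
  linarith [Real.exp_one_lt_d9]

theorem isBigO_sum_of_eventually_le {E : ℕ → ℝ} {k : ℕ} (hE : ∀ n, k ≤ n → 0 ≤ E n) {C : ℝ}
    (hC : 0 ≤ C)
    (h : ∀ᶠ n : ℕ in atTop, E n ≤ C * (Real.log n ^ (3 / 4 : ℝ) / √(n : ℝ))) :
    (fun T : ℕ => ∑ n ∈ Finset.Icc k T, E n) =O[atTop]
      fun T : ℕ => √(T : ℝ) * Real.log T ^ (3 / 4 : ℝ) := by
  obtain ⟨n₀, hn₀⟩ := eventually_atTop.mp h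
  set D := ∑ n ∈ Finset.Icc k (n₀ + 1), E n with hD
  have hD0 : 0 ≤ D := Finset.sum_nonneg fun n hn => hE n (Finset.mem_Icc.mp hn).1
  refine IsBigO.of_bound (D + C * 2) ?_
  filter_upwards [eventually_ge_atTop 3] with T hT
  have hL : 1 ≤ Real.log T ^ (3 / 4 : ℝ) :=
    Real.one_le_rpow (one_le_log_natCast hT) (by norm_num)
  have hs : 1 ≤ √(T : ℝ) := Real.one_le_sqrt.mpr (by exact_mod_cast (by omega : 1 ≤ T))
  rw [Real.norm_of_nonneg (Finset.sum_nonneg fun n hn => hE n (Finset.mem_Icc.mp hn).1),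
    Real.norm_of_nonneg (by positivity)]
  -- The finitely many terms before the rate sets in go into the constant `D`. In the others `log n`
  -- is replaced by `log T`; the guard `1 ≤ n` allows comparison with the sum from 1, as `k` may be
  -- 0.
  have hterm : ∀ n ∈ Finset.Icc k T, E n ≤ (if n ≤ n₀ then E n else 0) +
      (if 1 ≤ n then C * Real.log T ^ (3 / 4 : ℝ) * (1 / √(n : ℝ)) else 0) := fun n hn => by
    obtain ⟨hkn, hnT⟩ := Finset.mem_Icc.mp hn
    by_cases h1 : n ≤ n₀
    · rw [if_pos h1]
      have : 0 ≤ if 1 ≤ n then C * Real.log T ^ (3 / 4 : ℝ) * (1 / √(n : ℝ)) else 0 := by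
        split_ifs <;> positivity
      linarith
    · have h2 : 1 ≤ n := by omega
      rw [if_neg h1, if_pos h2, zero_add]
      refine (hn₀ n (by omega)).trans ?_
      rw [mul_assoc, mul_one_div]
      have hn0 : (0 : ℝ) < n := by exact_mod_cast h2
      have := Real.log_natCast_nonneg n
      gcongr
  have hsum1 : ∑ n ∈ Finset.Icc k T, (if n ≤ n₀ then E n else 0) ≤ D := by
    rw [← Finset.sum_filter]
    refine Finset.sum_le_sum_of_subset_of_nonneg (fun n hn => ?_)
      fun n hn _ => hE n (Finset.mem_Icc.mp hn).1
    rw [Finset.mem_filter, Finset.mem_Icc] at hn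
    exact Finset.mem_Icc.mpr ⟨hn.1.1, by omega⟩
  have hsum2 : ∑ n ∈ Finset.Icc k T,
      (if 1 ≤ n then C * Real.log T ^ (3 / 4 : ℝ) * (1 / √(n : ℝ)) else 0) ≤
      C * Real.log T ^ (3 / 4 : ℝ) * (2 * √(T : ℝ)) := by
    rw [← Finset.sum_filter]
    calc _ ≤ ∑ n ∈ Finset.Icc 1 T, C * Real.log T ^ (3 / 4 : ℝ) * (1 / √(n : ℝ)) := by
          refine Finset.sum_le_sum_of_subset_of_nonneg (fun n hn => ?_)
            fun n hn _ => by positivity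
          rw [Finset.mem_filter, Finset.mem_Icc] at hn
          exact Finset.mem_Icc.mpr ⟨hn.2, hn.1.2⟩
      _ ≤ _ := by
          rw [← Finset.mul_sum]
          gcongr
          exact sum_one_div_sqrt_le T
  calc ∑ n ∈ Finset.Icc k T, E n ≤ _ := Finset.sum_le_sum hterm
    _ ≤ D + C * Real.log T ^ (3 / 4 : ℝ) * (2 * √(T : ℝ)) := by
        rw [Finset.sum_add_distrib]; exact add_le_add hsum1 hsum2
    _ ≤ D * (√(T : ℝ) * Real.log T ^ (3 / 4 : ℝ)) +
        C * Real.log T ^ (3 / 4 : ℝ) * (2 * √(T : ℝ)) := by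
        gcongr
        exact le_mul_of_one_le_right hD0 (one_le_mul_of_one_le_of_one_le hs hL)
    _ = _ := by ring

/-! ### The good event -/

variable {K : ℕ} {X : Type*} [MeasurableSpace X] {μ : Measure X} {Ω : Type*}

section Pointwise

variable (p : Problem K X μ) (τ : Fin K → ℝ≥0) (A : ℕ → Ω → Fin K) (x : ℕ → Ω → X)

theorem sum_boost_le (t : ℕ) (ω : Ω) :
    ∑ a, boost τ A a t ω ≤ boostConst * (∑ a, (τ a : ℝ)) * √(Real.log t) := by
  rw [Finset.mul_sum, Finset.sum_mul]
  exact Finset.sum_le_sum fun a _ => boost_le τ A a t ω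

theorem sum_score_le (t : ℕ) (ω : Ω) :
    ∑ a, (estimate p A x a t ω + boost τ A a t ω) ≤
      totalWeight p A x t ω + boostConst * (∑ a, (τ a : ℝ)) * √t := by
  rw [Finset.sum_add_distrib]
  refine add_le_add (sum_estimate_le p A x t ω) ((sum_boost_le τ A t ω).trans ?_)
  have h0 : 0 ≤ ∑ a, (τ a : ℝ) := Finset.sum_nonneg fun a _ => (τ a).2
  have := boostConst_nonneg
  gcongr
  exact Real.log_le_self (Nat.cast_nonneg t)

/-- When all estimates are within their boosts, no arm has a small probability. -/
theorem le_proposal_of_deviation_le (hZ : ∀ a, 0 < p.Z a) {s t : ℕ} (hst : s ≤ t) (hs : 1 ≤ s)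
    (ht : 3 ≤ t) {ω : Ω} (h : ∀ b, |estimate p A x b s ω - p.Z b| ≤ boost τ A b s ω)
    (a : Fin K) :
    p.Z a / (∑ b, p.Z b + 2 * (boostConst * ∑ b, (τ b : ℝ))) / √(Real.log t) ≤
      proposal p τ A x a (s + 1) ω := by
  have hZs : 0 < ∑ b, p.Z b := Finset.sum_pos (fun b _ => hZ b) ⟨a, Finset.mem_univ a⟩
  have hτs : 0 ≤ ∑ b, (τ b : ℝ) := Finset.sum_nonneg fun b _ => (τ b).2
  have hc := boostConst_nonneg
  have hV : ∀ b, p.Z b ≤ estimate p A x b s ω + boost τ A b s ω := fun b => by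
    linarith [(abs_le.mp (h b)).1]
  have hS0 : 0 < ∑ b, (estimate p A x b s ω + boost τ A b s ω) :=
    Finset.sum_pos (fun b _ => (hZ b).trans_le (hV b)) ⟨a, Finset.mem_univ a⟩
  have hlog1 : 1 ≤ √(Real.log t) := Real.one_le_sqrt.mpr (one_le_log_natCast ht)
  have hlogs : √(Real.log s) ≤ √(Real.log t) := by
    have : (0 : ℝ) < s := by exact_mod_cast hs
    gcongr
  -- Only the trivial bound on the boosts is available here, as nothing is yet known about pulls.
  -- The factor `√(log t)` it loses turns the power `1/2` of the logarithm into `3/4`.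
  have hS : ∑ b, (estimate p A x b s ω + boost τ A b s ω) ≤
      (∑ b, p.Z b + 2 * (boostConst * ∑ b, (τ b : ℝ))) * √(Real.log t) := by
    have h1 : ∑ b, (estimate p A x b s ω + boost τ A b s ω) ≤
        ∑ b, p.Z b + 2 * ∑ b, boost τ A b s ω := by
      rw [Finset.mul_sum, ← Finset.sum_add_distrib]
      exact Finset.sum_le_sum fun b _ => by linarith [(abs_le.mp (h b)).2]
    have h2 := sum_boost_le τ A s ω
    have h3 : boostConst * (∑ a, (τ a : ℝ)) * √(Real.log s) ≤
        boostConst * (∑ a, (τ a : ℝ)) * √(Real.log t) := by gcongr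
    have h4 := le_mul_of_one_le_right hZs.le hlog1
    linarith
  rw [proposal, Nat.add_sub_cancel, div_div]
  exact div_le_div₀ ((hZ a).le.trans (hV a)) (hV a) hS0 hS

/-- The estimates are within their boosts and every arm was chosen `κ t / √(log t)` times. -/
def wellExplored (κ : ℝ) (t : ℕ) : Set Ω :=
  {ω | ∀ a, |estimate p A x a t ω - p.Z a| ≤ boost τ A a t ω ∧
    κ * (t / √(Real.log t)) ≤ pulls A a t ω}

end Pointwise

theorem Problem.targetProb_pos {p : Problem K X μ} (hZ : ∀ a, 0 < p.Z a) (a : Fin K) :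
    0 < p.targetProb a :=
  div_pos (hZ a) (Finset.sum_pos (fun b _ => hZ b) ⟨a, Finset.mem_univ a⟩)

theorem Problem.sum_targetProb {p : Problem K X μ} [Nonempty (Fin K)] (hZ : ∀ a, 0 < p.Z a) :
    ∑ a, p.targetProb a = 1 := by
  simp only [Problem.targetProb]
  rw [← Finset.sum_div, div_self (Finset.sum_pos (fun b _ => hZ b) Finset.univ_nonempty).ne']

/-! ### Positivity, integrability and expectation of the regret -/

namespace IsRun

variable {mΩ : MeasurableSpace Ω} {p : Problem K X μ} {τ : Fin K → ℝ≥0} {P : Measure Ω}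
  {ℱ : Filtration ℕ mΩ} {A : ℕ → Ω → Fin K} {x : ℕ → Ω → X}

theorem measurable_regret (hrun : IsRun p τ P ℱ A x) (t : ℕ) :
    Measurable (regret p τ A x (t + 1)) := by
  refine Finset.measurable_fun_sum _ fun a _ => ?_
  have := (hrun.measurable_proposal a t).mono (ℱ.le t) le_rfl
  fun_prop

theorem measurableSet_wellExplored (hrun : IsRun p τ P ℱ A x) (κ : ℝ) (t : ℕ) :
    MeasurableSet (wellExplored p τ A x κ t) := by
  have h1 : ∀ a, Measurable (estimate p A x a t) := fun a =>
    (hrun.measurable_estimate a t).mono (ℱ.le t) le_rfl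
  have h2 : ∀ a, Measurable (boost τ A a t) := fun a =>
    (hrun.measurable_boost a t).mono (ℱ.le t) le_rfl
  have h3 : ∀ a, Measurable fun ω => (pulls A a t ω : ℝ) := fun a =>
    measurable_from_top.comp ((hrun.measurable_pulls a t).mono (ℱ.le t) le_rfl)
  have : wellExplored p τ A x κ t = ⋂ a,
      ({ω | |estimate p A x a t ω - p.Z a| ≤ boost τ A a t ω} ∩
        {ω | κ * (t / √(Real.log t)) ≤ pulls A a t ω}) := by
    ext ω; simp [wellExplored]
  rw [this]
  exact MeasurableSet.iInter fun a =>
    (measurableSet_le (((h1 a).sub_const _).abs) (h2 a)).inter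
      (measurableSet_le measurable_const (h3 a))

variable [IsProbabilityMeasure P]

theorem proposal_pos_of_two_le (hrun : IsRun p τ P ℱ A x) (hτ : p.SubGaussianWeights τ)
    (hZ : ∀ a, 0 < p.Z a) :
    ∀ᵐ ω ∂P, ∀ t, 2 ≤ t → K ≤ t → ∀ a, 0 < proposal p τ A x a (t + 1) ω := by
  choose κ hκ hV using hrun.exists_le_score hτ hZ
  filter_upwards [ae_all_iff.mpr hV] with ω hω t ht hK a
  have h : ∀ a, 0 < estimate p A x a t ω + boost τ A a t ω := fun a =>
    (div_pos (hκ a) (Real.sqrt_pos.mpr (by positivity))).trans_le (hω a t ht hK)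
  exact div_pos (h a) (Finset.sum_pos (fun b _ => h b) ⟨a, Finset.mem_univ a⟩)

/-- The pathwise bound for use on the exceptional event: the score floor controls the reciprocals,
the total weight controls the sum of scores. -/
theorem exists_regret_le (hrun : IsRun p τ P ℱ A x) (hτ : p.SubGaussianWeights τ)
    [Nonempty (Fin K)] (hZ : ∀ a, 0 < p.Z a) :
    ∃ C : ℝ, 0 ≤ C ∧ ∀ᵐ ω ∂P, ∀ t : ℕ, 2 ≤ t → K ≤ t →
      0 ≤ regret p τ A x (t + 1) ω ∧
        regret p τ A x (t + 1) ω ≤ C * √t + totalWeight p A x t ω := by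
  choose κ hκ hV using hrun.exists_le_score hτ hZ
  have hτs : 0 ≤ ∑ b, (τ b : ℝ) := Finset.sum_nonneg fun b _ => (τ b).2
  have hc := boostConst_nonneg
  have hκs : 0 ≤ ∑ a, 1 / κ a := Finset.sum_nonneg fun a _ => (one_div_pos.mpr (hκ a)).le
  refine ⟨∑ a, 1 / κ a + boostConst * ∑ a, (τ a : ℝ), by positivity, ?_⟩
  filter_upwards [ae_all_iff.mpr hV] with ω hω t ht hK
  have hs : 0 < √(t : ℝ) := Real.sqrt_pos.mpr (by positivity)
  have hpos : ∀ a, 0 < estimate p A x a t ω + boost τ A a t ω := fun a =>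
    (div_pos (hκ a) hs).trans_le (hω a t ht hK)
  refine ⟨sum_mul_log_div_nonneg (Problem.targetProb_pos hZ) (Problem.sum_targetProb hZ) hpos,
    (sum_mul_log_div_le (Problem.targetProb_pos hZ) (Problem.sum_targetProb hZ) hpos).trans ?_⟩
  have h1 : ∑ a, 1 / (estimate p A x a t ω + boost τ A a t ω) ≤ (∑ a, 1 / κ a) * √t := by
    rw [Finset.sum_mul]
    refine Finset.sum_le_sum fun a _ => ?_
    calc _ ≤ 1 / (κ a / √t) :=
          one_div_le_one_div_of_le (div_pos (hκ a) hs) (hω a t ht hK)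
      _ = _ := by rw [one_div_div, one_div_mul_eq_div]
  have h2 := sum_score_le p τ A x t ω
  linarith

/-- For a single arm, a run must choose it with probability one. -/
theorem proposal_eq_one (hrun : IsRun p τ P ℱ A x) [Subsingleton (Fin K)] {t : ℕ} (hK : K ≤ t) :
    ∀ᵐ ω ∂P, ∀ a, proposal p τ A x a (t + 1) ω = 1 := by
  filter_upwards [hrun.sum_armProb t] with ω hω a
  rw [Fintype.sum_subsingleton _ a] at hω
  simpa [armProb, not_lt.mpr hK] using hω

theorem proposal_pos (hrun : IsRun p τ P ℱ A x) (hτ : p.SubGaussianWeights τ)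
    (hZ : ∀ a, 0 < p.Z a) {t : ℕ} (hK : K ≤ t) :
    ∀ᵐ ω ∂P, ∀ a, 0 < proposal p τ A x a (t + 1) ω := by
  -- The score floor starts at `t = 2`, and `K ≤ t < 2` forces `K ≤ 1`. With a single arm the
  -- proposal is one almost surely.
  by_cases hK1 : K ≤ 1
  · have : Subsingleton (Fin K) := Fin.subsingleton_iff_le_one.mpr hK1
    filter_upwards [hrun.proposal_eq_one hK] with ω hω a
    rw [hω a]
    exact one_pos
  · filter_upwards [hrun.proposal_pos_of_two_le hτ hZ] with ω hω
    exact hω t (by omega) hK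

theorem regret_nonneg (hrun : IsRun p τ P ℱ A x) (hτ : p.SubGaussianWeights τ)
    [Nonempty (Fin K)] (hZ : ∀ a, 0 < p.Z a) {t : ℕ} (hK : K ≤ t) :
    ∀ᵐ ω ∂P, 0 ≤ regret p τ A x (t + 1) ω := by
  by_cases hK1 : K ≤ 1
  · have : Subsingleton (Fin K) := Fin.subsingleton_iff_le_one.mpr hK1
    filter_upwards [hrun.proposal_eq_one hK] with ω hω
    have a := Classical.arbitrary (Fin K)
    have h := Problem.sum_targetProb hZ
    rw [Fintype.sum_subsingleton _ a] at h
    rw [regret, Fintype.sum_subsingleton _ a, h, hω a]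
    simp
  · obtain ⟨C, _, h⟩ := hrun.exists_regret_le hτ hZ
    filter_upwards [h] with ω hω
    exact (hω t (by omega) hK).1

theorem integrable_regret (hrun : IsRun p τ P ℱ A x) (hτ : p.SubGaussianWeights τ)
    [Nonempty (Fin K)] (hZ : ∀ a, 0 < p.Z a) {t : ℕ} (hK : K ≤ t) :
    Integrable (regret p τ A x (t + 1)) P := by
  by_cases hK1 : K ≤ 1
  · have : Subsingleton (Fin K) := Fin.subsingleton_iff_le_one.mpr hK1
    refine (integrable_zero Ω ℝ P).congr ?_
    filter_upwards [hrun.proposal_eq_one hK] with ω hω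
    have a := Classical.arbitrary (Fin K)
    have h := Problem.sum_targetProb hZ
    rw [Fintype.sum_subsingleton _ a] at h
    rw [regret, Fintype.sum_subsingleton _ a, h, hω a]
    simp
  · obtain ⟨C, _, h⟩ := hrun.exists_regret_le hτ hZ
    obtain ⟨M, _, hM⟩ := hrun.exists_integral_sq_totalWeight_le hτ
    refine Integrable.mono' ((integrable_const (C * √t)).add ((hM t).1.integrable (by norm_num)))
      (hrun.measurable_regret t).aestronglyMeasurable ?_
    filter_upwards [h] with ω hω
    have := hω t (by omega) hK
    rw [Real.norm_of_nonneg this.1]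
    exact this.2

theorem exists_measure_compl_wellExplored_le (hrun : IsRun p τ P ℱ A x)
    (hτ : p.SubGaussianWeights τ) [Nonempty (Fin K)] (hZ : ∀ a, 0 < p.Z a) :
    ∃ κ : ℝ, 0 < κ ∧ ∃ M : ℝ, 0 ≤ M ∧ ∀ᶠ t : ℕ in atTop,
      P (wellExplored p τ A x κ t)ᶜ ≤ ENNReal.ofReal (M / (t : ℝ) ^ 3) := by
  obtain ⟨a₀, -, ha₀⟩ := Finset.exists_min_image Finset.univ p.Z Finset.univ_nonempty
  have hZs : 0 < ∑ b, p.Z b := Finset.sum_pos (fun b _ => hZ b) Finset.univ_nonempty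
  have hτs : 0 ≤ ∑ b, (τ b : ℝ) := Finset.sum_nonneg fun b _ => (τ b).2
  have hc := boostConst_nonneg
  set W := ∑ b, p.Z b + 2 * (boostConst * ∑ b, (τ b : ℝ)) with hW
  have hW0 : 0 < W := by positivity
  have hκ0 : 0 < p.Z a₀ / W := div_pos (hZ a₀) hW0
  have hκ1 : p.Z a₀ / W ≤ 1 := by
    rw [div_le_one hW0]
    have := Finset.single_le_sum (fun b _ => (hZ b).le) (Finset.mem_univ a₀)
    have : 0 ≤ 2 * (boostConst * ∑ b, (τ b : ℝ)) := by positivity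
    linarith
  -- With `k ≥ t / 3` iterations of probability at least `η`, the threshold `η t / 12` leaves the
  -- exponent `η t / 12 - η k / 2 ≤ -η t / 12`. In `33 = 32 + 1`, the 32 is `2 · 2⁴` from deviations
  -- at times `s ≥ t / 2`, and the 1 comes from the pull counts.
  refine ⟨p.Z a₀ / W / 12, by positivity, 33 * K, by positivity, ?_⟩
  filter_upwards [eventually_exp_neg_div_sqrt_log_le (show 0 < p.Z a₀ / W / 12 by positivity),
    eventually_ge_atTop 3, eventually_ge_atTop (2 * K)] with t hexp ht3 htK
  have ht0 : (0 : ℝ) < t := by positivity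
  have hlog1 : 1 ≤ √(Real.log t) := Real.one_le_sqrt.mpr (one_le_log_natCast ht3)
  -- The window is the second half of the iterations; `2 * K ≤ t` places it after the initial draws,
  -- where `armProb` is the proposal.
  obtain ⟨k, hk⟩ : ∃ k, k = t / 2 := ⟨_, rfl⟩
  obtain ⟨m, hm⟩ : ∃ m, m = t - k := ⟨_, rfl⟩
  have hmk : m + k = t := by omega
  have hKpos : 0 < K := Fin.pos a₀
  set η := p.Z a₀ / W / √(Real.log t) with hη
  have hη0 : 0 < η := by positivity
  have hη1 : η ≤ 1 := (div_le_self hκ0.le hlog1).trans hκ1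
  have hk3 : (t : ℝ) / 3 ≤ k := by
    rw [div_le_iff₀ (by norm_num)]
    exact_mod_cast (by omega : t ≤ k * 3)
  have hsub : (wellExplored p τ A x (p.Z a₀ / W / 12) t)ᶜ ⊆
      (⋃ s ∈ Finset.Icc m t, ⋃ b ∈ Finset.univ (α := Fin K),
        {ω | ¬ |estimate p A x b s ω - p.Z b| ≤ boost τ A b s ω}) ∪
      ⋃ a ∈ Finset.univ (α := Fin K), {ω | (∀ i < k, η ≤ armProb p τ A x (m + i) a ω) ∧
        pulls A a (m + k) ω < η * t / 12} := by
    intro ω hω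
    by_contra hn
    rw [Set.mem_union, not_or] at hn
    obtain ⟨hn1, hn2⟩ := hn
    have hdev : ∀ s ∈ Finset.Icc m t, ∀ b,
        |estimate p A x b s ω - p.Z b| ≤ boost τ A b s ω := by
      intro s hs b
      by_contra hb
      exact hn1 (Set.mem_biUnion (Finset.mem_coe.mpr hs)
        (Set.mem_biUnion (Finset.mem_coe.mpr (Finset.mem_univ b)) hb))
    refine hω fun a => ⟨hdev t (Finset.mem_Icc.mpr ⟨by omega, le_rfl⟩) a, ?_⟩
    by_contra ha
    refine hn2 (Set.mem_biUnion (Finset.mem_coe.mpr (Finset.mem_univ a)) ⟨fun i hi => ?_, ?_⟩)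
    · have h1 := le_proposal_of_deviation_le p τ A x hZ (show m + i ≤ t by omega)
        (by omega) ht3 (hdev (m + i) (Finset.mem_Icc.mpr ⟨by omega, by omega⟩)) a
      rw [armProb, if_neg (by omega)]
      refine le_trans ?_ h1
      rw [hη, ← hW]
      gcongr
      exact ha₀ a (Finset.mem_univ a)
    · rw [hmk]
      refine (not_le.mp ha).trans_le (le_of_eq ?_)
      rw [hη]
      ring
  have hbound1 : ∀ s ∈ Finset.Icc m t, ∀ b : Fin K,
      P {ω | ¬ |estimate p A x b s ω - p.Z b| ≤ boost τ A b s ω} ≤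
        ENNReal.ofReal (32 / (t : ℝ) ^ 4) := fun s hs b => by
    obtain ⟨hms, -⟩ := Finset.mem_Icc.mp hs
    refine (hrun.measure_deviation_le hτ b (by omega) (by omega)).trans
      (ENNReal.ofReal_le_ofReal ?_)
    have hs2 : (t : ℝ) / 2 ≤ s := by
      rw [div_le_iff₀ (by norm_num)]
      exact_mod_cast (by omega : t ≤ s * 2)
    calc 2 / (s : ℝ) ^ 4 ≤ 2 / (t / 2 : ℝ) ^ 4 := by gcongr
      _ = _ := by field_simp; norm_num
  have hbound2 : ∀ a : Fin K, P {ω | (∀ i < k, η ≤ armProb p τ A x (m + i) a ω) ∧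
      pulls A a (m + k) ω < η * t / 12} ≤ ENNReal.ofReal (1 / (t : ℝ) ^ 3) := fun a => by
    refine (hrun.measure_pulls_lt_le a hη0.le hη1 m k _).trans (ENNReal.ofReal_le_ofReal ?_)
    refine le_trans (Real.exp_le_exp.mpr ?_) hexp
    have h1 : p.Z a₀ / W / 12 * (t / √(Real.log t)) = η * t / 12 := by rw [hη]; ring
    rw [h1]
    nlinarith
  calc _ ≤ _ := (measure_mono hsub).trans (measure_union_le _ _)
    _ ≤ ∑ s ∈ Finset.Icc m t, ∑ b : Fin K, ENNReal.ofReal (32 / (t : ℝ) ^ 4) +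
        ∑ a : Fin K, ENNReal.ofReal (1 / (t : ℝ) ^ 3) := by
        refine add_le_add ?_ ?_
        · refine (measure_biUnion_finset_le _ _).trans (Finset.sum_le_sum fun s hs => ?_)
          exact (measure_biUnion_finset_le _ _).trans
            (Finset.sum_le_sum fun b _ => hbound1 s hs b)
        · exact (measure_biUnion_finset_le _ _).trans (Finset.sum_le_sum fun a _ => hbound2 a)
    _ ≤ (t : ℝ≥0∞) * (K * ENNReal.ofReal (32 / (t : ℝ) ^ 4)) +
        K * ENNReal.ofReal (1 / (t : ℝ) ^ 3) := by
        simp only [Finset.sum_const, nsmul_eq_mul, Nat.card_Icc, Finset.card_univ,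
          Fintype.card_fin]
        gcongr
        omega
    _ = ENNReal.ofReal (33 * K / (t : ℝ) ^ 3) := by
        simp only [← ENNReal.ofReal_natCast]
        rw [← ENNReal.ofReal_mul (by positivity), ← ENNReal.ofReal_mul (by positivity),
          ← ENNReal.ofReal_mul (by positivity), ← ENNReal.ofReal_add (by positivity)
            (by positivity)]
        congr 1
        field_simp
        norm_num

/-- Enough pulls give `log t / N ≤ (log t)^(3/2) / (κ t)`, and the boost is proportional to the
square root. -/
theorem regret_le_of_mem_wellExplored [Nonempty (Fin K)] (hZ : ∀ a, 0 < p.Z a) {κ : ℝ}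
    (hκ : 0 < κ) {t : ℕ} (ht : 3 ≤ t) {ω : Ω} (hω : ω ∈ wellExplored p τ A x κ t) :
    regret p τ A x (t + 1) ω ≤ 2 * (boostConst * (∑ a, (τ a : ℝ)) / √κ) / (∑ b, p.Z b) *
      (Real.log t ^ (3 / 4 : ℝ) / √(t : ℝ)) := by
  have hZs : 0 < ∑ b, p.Z b := Finset.sum_pos (fun b _ => hZ b) Finset.univ_nonempty
  have hL : 0 < Real.log t := one_pos.trans_le (one_le_log_natCast ht)
  have ht0 : (0 : ℝ) < t := by positivity
  have h1 : regret p τ A x (t + 1) ω ≤ 2 * (∑ b, boost τ A b t ω) / ∑ b, p.Z b :=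
    sum_mul_log_div_le_of_close (e := fun a => estimate p A x a t ω)
      (σ := fun a => boost τ A a t ω) hZ fun a => (hω a).1
  have h2 : ∀ a, boost τ A a t ω ≤
      boostConst * τ a * ((Real.log t ^ (3 / 4 : ℝ) / √(t : ℝ)) / √κ) := fun a => by
    refine mul_le_mul_of_nonneg_left ?_ (mul_nonneg boostConst_nonneg (τ a).2)
    have hL4 : Real.log t ^ (3 / 4 : ℝ) = √(Real.log t * √(Real.log t)) := by
      rw [Real.sqrt_eq_rpow, Real.sqrt_eq_rpow]
      nth_rewrite 2 [← Real.rpow_one (Real.log t)]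
      rw [← Real.rpow_add hL, ← Real.rpow_mul hL.le]
      norm_num
    rw [hL4, ← Real.sqrt_div (by positivity), ← Real.sqrt_div (by positivity)]
    refine Real.sqrt_le_sqrt ?_
    have hs : 0 < √(Real.log t) := Real.sqrt_pos.mpr hL
    calc Real.log t / pulls A a t ω ≤ Real.log t / (κ * (t / √(Real.log t))) := by
          gcongr
          exact (hω a).2
      _ = _ := by field_simp
  calc _ ≤ _ := h1
    _ ≤ 2 * (∑ a, boostConst * τ a * ((Real.log t ^ (3 / 4 : ℝ) / √(t : ℝ)) / √κ)) /
        ∑ b, p.Z b := by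
        gcongr
        exact h2 _
    _ = _ := by
        rw [← Finset.sum_mul, ← Finset.mul_sum]
        ring

theorem exists_integral_regret_succ_le (hrun : IsRun p τ P ℱ A x) (hτ : p.SubGaussianWeights τ)
    [Nonempty (Fin K)] (hZ : ∀ a, 0 < p.Z a) :
    ∃ C : ℝ, 0 ≤ C ∧ ∀ᶠ t : ℕ in atTop, ∫ ω, regret p τ A x (t + 1) ω ∂P ≤
      C * (Real.log t ^ (3 / 4 : ℝ) / √(t : ℝ)) := by
  obtain ⟨κ, hκ, M, hM0, hM⟩ := hrun.exists_measure_compl_wellExplored_le hτ hZ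
  obtain ⟨C₂, hC₂, hR⟩ := hrun.exists_regret_le hτ hZ
  obtain ⟨M₂, hM₂, hQ⟩ := hrun.exists_integral_sq_totalWeight_le hτ
  have hZs : 0 < ∑ b, p.Z b := Finset.sum_pos (fun b _ => hZ b) Finset.univ_nonempty
  have hτs : 0 ≤ ∑ b, (τ b : ℝ) := Finset.sum_nonneg fun b _ => (τ b).2
  have hc := boostConst_nonneg
  set C₁ := 2 * (boostConst * (∑ a, (τ a : ℝ)) / √κ) / (∑ b, p.Z b) with hC₁
  have hC₁0 : 0 ≤ C₁ := by positivity
  refine ⟨C₁ + (C₂ * M + M + M₂), by positivity, ?_⟩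
  filter_upwards [hM, eventually_ge_atTop 3, eventually_ge_atTop K] with t hMt ht3 htK
  have ht1 : (1 : ℝ) ≤ t := by exact_mod_cast (by omega : 1 ≤ t)
  have ht0 : (0 : ℝ) < t := by positivity
  have hs : 0 < √(t : ℝ) := Real.sqrt_pos.mpr ht0
  have hs2 : √(t : ℝ) ^ 2 = t := Real.sq_sqrt ht0.le
  have hL : 1 ≤ Real.log t ^ (3 / 4 : ℝ) :=
    Real.one_le_rpow (one_le_log_natCast ht3) (by norm_num)
  set B := (wellExplored p τ A x κ t)ᶜ with hB
  have hBm : MeasurableSet B := (hrun.measurableSet_wellExplored κ t).compl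
  -- The level `t^(5/2)` balances the two parts of `W ≤ r + W² / r` for the total weight `W`:
  -- against probability `O(t⁻³)` the first gives `t^(-1/2)`, and so does `E[W²] / r` with `E[W²] =
  -- O(t²)`.
  set r := (t : ℝ) ^ 2 * √t with hr
  have hr0 : 0 < r := by positivity
  have hbound : ∀ᵐ ω ∂P, regret p τ A x (t + 1) ω ≤
      C₁ * (Real.log t ^ (3 / 4 : ℝ) / √(t : ℝ)) +
        (B.indicator (fun _ => C₂ * √t + r) ω + totalWeight p A x t ω ^ 2 / r) := by
    filter_upwards [hR] with ω hω
    have hq : 0 ≤ totalWeight p A x t ω ^ 2 / r := by positivity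
    by_cases hωB : ω ∈ B
    · rw [Set.indicator_of_mem hωB]
      have h1 := (hω t (by omega) htK).2
      have h2 : 0 ≤ C₁ * (Real.log t ^ (3 / 4 : ℝ) / √(t : ℝ)) := by positivity
      have h3 : totalWeight p A x t ω ≤ r + totalWeight p A x t ω ^ 2 / r := by
        have h0 := totalWeight_nonneg p A x t ω
        rw [← sub_nonneg]
        have : r + totalWeight p A x t ω ^ 2 / r - totalWeight p A x t ω =
            (r ^ 2 + totalWeight p A x t ω ^ 2 - r * totalWeight p A x t ω) / r := by
          field_simp
        rw [this]
        refine div_nonneg ?_ hr0.le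
        nlinarith [sq_nonneg (r - totalWeight p A x t ω)]
      linarith
    · rw [Set.indicator_of_notMem hωB]
      have := regret_le_of_mem_wellExplored hZ hκ ht3 (not_not.mp hωB : ω ∈ wellExplored p τ A x κ t)
      linarith
  have hi1 : Integrable (B.indicator fun _ => C₂ * √t + r) P :=
    (integrable_const _).indicator hBm
  have hi2 : Integrable (fun ω => totalWeight p A x t ω ^ 2 / r) P :=
    (hQ t).1.integrable_sq.div_const r
  have hPB : P.real B ≤ M / (t : ℝ) ^ 3 := ENNReal.toReal_le_of_le_ofReal (by positivity) hMt
  calc ∫ ω, regret p τ A x (t + 1) ω ∂P ≤ _ := integral_mono_ae (hrun.integrable_regret hτ hZ htK)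
        ((integrable_const _).add (hi1.add hi2)) hbound
    _ = C₁ * (Real.log t ^ (3 / 4 : ℝ) / √(t : ℝ)) + (P.real B * (C₂ * √t + r) +
        (∫ ω, totalWeight p A x t ω ^ 2 ∂P) / r) := by
        rw [integral_add' (integrable_const _) (hi1.add hi2), integral_add' hi1 hi2, integral_indicator_const _ hBm, integral_div]
        simp
    _ ≤ C₁ * (Real.log t ^ (3 / 4 : ℝ) / √(t : ℝ)) + (M / (t : ℝ) ^ 3 * (C₂ * √t + r) +
        M₂ * (t : ℝ) ^ 2 / r) := by
        gcongr
        exact (hQ t).2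
    _ ≤ C₁ * (Real.log t ^ (3 / 4 : ℝ) / √(t : ℝ)) + (C₂ * M + M + M₂) * (1 / √t) := by
        gcongr
        have e1 : M / (t : ℝ) ^ 3 * (C₂ * √t + r) + M₂ * (t : ℝ) ^ 2 / r =
            (C₂ * M / (t : ℝ) ^ 2 + M + M₂) * (1 / √t) := by
          rw [hr]
          field_simp
          rw [hs2]
          ring
        rw [e1]
        gcongr
        exact div_le_self (by positivity) (one_le_pow₀ ht1)
    _ ≤ C₁ * (Real.log t ^ (3 / 4 : ℝ) / √(t : ℝ)) +
        (C₂ * M + M + M₂) * (Real.log t ^ (3 / 4 : ℝ) / √(t : ℝ)) := by gcongr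
    _ = _ := by ring

theorem exists_integral_regret_le (hrun : IsRun p τ P ℱ A x) (hτ : p.SubGaussianWeights τ)
    [Nonempty (Fin K)] (hZ : ∀ a, 0 < p.Z a) :
    ∃ C : ℝ, 0 ≤ C ∧ ∀ᶠ t : ℕ in atTop, ∫ ω, regret p τ A x t ω ∂P ≤
      C * (Real.log t ^ (3 / 4 : ℝ) / √(t : ℝ)) := by
  obtain ⟨C, hC, h⟩ := hrun.exists_integral_regret_succ_le hτ hZ
  -- The index shift costs `√2`, since `t + 1 ≤ 2 t`.
  refine ⟨C * √2, by positivity, ?_⟩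
  rw [← map_add_atTop_eq_nat 1, eventually_map]
  filter_upwards [h, eventually_ge_atTop 1] with t ht ht1
  have ht0 : (1 : ℝ) ≤ t := by exact_mod_cast ht1
  have hs : 0 < √(t : ℝ) := Real.sqrt_pos.mpr (by positivity)
  refine ht.trans ?_
  rw [mul_assoc]
  gcongr
  have h1 : √((t + 1 : ℕ) : ℝ) ≤ √2 * √t := by
    rw [← Real.sqrt_mul (by norm_num)]
    refine Real.sqrt_le_sqrt ?_
    push_cast
    linarith
  have h2 : Real.log t ^ (3 / 4 : ℝ) ≤ Real.log ((t + 1 : ℕ) : ℝ) ^ (3 / 4 : ℝ) := by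
    have := Real.log_natCast_nonneg t
    gcongr
    omega
  have h3 : 0 < √((t + 1 : ℕ) : ℝ) := Real.sqrt_pos.mpr (by positivity)
  have h4 : 0 ≤ Real.log t ^ (3 / 4 : ℝ) := Real.rpow_nonneg (Real.log_natCast_nonneg t) _
  rw [mul_div_assoc', div_le_div_iff₀ hs h3]
  calc _ ≤ Real.log ((t + 1 : ℕ) : ℝ) ^ (3 / 4 : ℝ) * (√2 * √t) := by gcongr
    _ = _ := by ring

end IsRun

end Daisee

/-! ### The main theorem -/

theorem theorem1 {K : ℕ} {X : Type*} [MeasurableSpace X] {μ : Measure X}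
    (p : Daisee.Problem K X μ) (hZ : ∀ a, 0 < p.Z a)
    (τ : Fin K → ℝ≥0) (hτ : p.SubGaussianWeights τ)
    {Ω : Type*} {mΩ : MeasurableSpace Ω} (P : Measure Ω) [IsProbabilityMeasure P]
    (ℱ : Filtration ℕ mΩ)
    (A : ℕ → Ω → Fin K) (x : ℕ → Ω → X) (hrun : Daisee.IsRun p τ P ℱ A x) :
    (∀ t, K + 1 ≤ t →
      (∀ᵐ ω ∂P, ∀ a, 0 < Daisee.proposal p τ A x a t ω) ∧
        Integrable (Daisee.regret p τ A x t) P) ∧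
    (fun t : ℕ => ∫ ω, Daisee.regret p τ A x t ω ∂P) =O[atTop]
      (fun t : ℕ => (t : ℝ) ^ (-(1 / 2) : ℝ) * Real.log (t : ℝ) ^ (3 / 4 : ℝ)) ∧
    (fun T : ℕ => ∫ ω, ∑ t ∈ Finset.Icc (K + 1) T, Daisee.regret p τ A x t ω ∂P) =O[atTop]
      (fun T : ℕ => √(T : ℝ) * Real.log (T : ℝ) ^ (3 / 4 : ℝ)) := by
  have : Nonempty Ω := P.nonempty_of_neZero
  -- The case `K = 0` cannot occur: `Ω` is nonempty and `A` takes values in `Fin K`. Index 0 is no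
  -- iteration; only the type of `A 0` matters.
  have : Nonempty (Fin K) := ⟨A 0 (Classical.arbitrary Ω)⟩
  have hint : ∀ t, K + 1 ≤ t → Integrable (Daisee.regret p τ A x t) P := fun t ht => by
    obtain ⟨s, rfl⟩ : ∃ s, t = s + 1 := ⟨t - 1, by omega⟩
    exact hrun.integrable_regret hτ hZ (by omega)
  have hnonneg : ∀ t, K + 1 ≤ t → 0 ≤ ∫ ω, Daisee.regret p τ A x t ω ∂P := fun t ht => by
    obtain ⟨s, rfl⟩ : ∃ s, t = s + 1 := ⟨t - 1, by omega⟩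
    exact integral_nonneg_of_ae (hrun.regret_nonneg hτ hZ (by omega))
  obtain ⟨C, hC, hle⟩ := hrun.exists_integral_regret_le hτ hZ
  refine ⟨fun t ht => ⟨?_, hint t ht⟩, ?_, ?_⟩
  · obtain ⟨s, rfl⟩ : ∃ s, t = s + 1 := ⟨t - 1, by omega⟩
    exact hrun.proposal_pos hτ hZ (by omega)
  · refine IsBigO.of_bound C ?_
    filter_upwards [hle, eventually_ge_atTop (K + 1)] with t ht htK
    have hlog := Real.log_natCast_nonneg t
    rw [Real.norm_of_nonneg (hnonneg t htK), Real.norm_of_nonneg (by positivity),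
      Real.rpow_neg (by positivity), ← Real.sqrt_eq_rpow, inv_mul_eq_div]
    exact ht
  · have hsum : ∀ T : ℕ, ∫ ω, ∑ t ∈ Finset.Icc (K + 1) T, Daisee.regret p τ A x t ω ∂P =
        ∑ t ∈ Finset.Icc (K + 1) T, ∫ ω, Daisee.regret p τ A x t ω ∂P := fun T =>
      integral_finsetSum _ fun t ht => hint t (Finset.mem_Icc.mp ht).1
    simp_rw [hsum]
    exact Daisee.isBigO_sum_of_eventually_le hnonneg hC hle
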